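/- Fix an integer $n\ge 1$ and let $dv$ be Lebesgue measure on $\mathbb C^n$. A weight is a non-negative locally integrable function $w$ on $\mathbb C^n$. Let $Q_r(z)$ be the cube in $\mathbb C^n=\mathbb R^{2n}$ with centre $z$ and side length $r$. For $1<p<\infty$ and $\frac1p+\frac1{p'}=1$, the class $A_p^{\mathrm{restricted}}$ consists of the weights $w$ with $w>0$ a.e. such that for some $r>0$ $$\sup_{z\in\mathbb C^n}\Big(\frac1{v(Q_r(z))}\int_{Q_r(z)}w\,dv\Big)\Big(\frac1{v(Q_r(z))}\int_{Q_r(z)}w^{-p'/p}\,dv\Big)^{p/p'}<\infty ,$$ and $A_1^{\mathrm{restricted}}$ consists of the weights $w$ with $w>0$ a.e. such that for some $r>0$ $$\sup_{z\in\mathbb C^n}\frac{\int_{Q_r(z)}w\,dv}{v(Q_r(z))\,\operatorname{ess\,inf}_{Q_r(z)}w}<\infty .$$ Put $A_\infty^{\mathrm{restricted}}=\bigcup_{1\le p<\infty}A_p^{\mathrm{restricted}}$. For $0<p,\alpha<\infty$ the weighted Fock space $F^p_{\alpha,w}$ is the set of entire functions $f$ on $\mathbb C^n$ with $$\|f\|^p_{F^p_{\alpha,w}}=\int_{\mathbb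 C^n}|f(z)|^pe^{-\frac{p\alpha}2|z|^2}w(z)\,dv(z)<\infty .$$ For $\lambda>0$, a positive Borel measure $\mu$ on $\mathbb C^n$ is called a $(w,\lambda)$-Fock–Carleson measure if there are $p,q,\alpha\in(0,\infty)$ with $\lambda=q/p$ and a constant $C>0$ such that $$\Big(\int_{\mathbb C^n}|f(z)|^qe^{-\frac{q\alpha}2|z|^2}\,d\mu(z)\Big)^{1/q}\le C\,\|f\|_{F^p_{\alpha,w}}\qquad\text{for all } f\in F^p_{\alpha,w}.$$ **Theorem.** Let $w\in A_\infty^{\mathrm{restricted}}$ and let $\mu$ be a positive Borel measure on $\mathbb C^n$. Let $k\ge1$ be an integer, let $0<p_j,q_j<\infty$ for $j=1,\dots,k$, and put $\lambda=\sum_{j=1}^k q_j/p_j$. For $\alpha_1,\dots,\alpha_k\in(0,\infty)$ consider the following property: there is $C>0$ such that for all $f_j\in F^{p_j}_{\alpha_j,w}$, $j=1,\dots,k$, $$\int_{\mathbb C^n}\prod_{j=1}^k|f_j(z)|^{q_j}e^{-\frac{q_j\alpha_j}2|z|^2}\,d\mu(z)\le C\prod_{j=1}^k\|f_j\|^{q_j}_{F^{p_j}_{\alpha_j,w}}.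 \tag{$*$}$$ Then the following are equivalent: 1. $\mu$ is a $(w,\lambda)$-Fock–Carleson measure; 2. property $(*)$ holds for some $\alpha_1,\dots,\alpha_k\in(0,\infty)$; 3. property $(*)$ holds for all $\alpha_1,\dots,\alpha_k\in(0,\infty)$. -/

import Mathlib

open MeasureTheory
open scoped ENNReal

noncomputable section

/-- The square `|z|²` of the Euclidean norm of `z ∈ ℂⁿ`. (The type `Fin n → ℂ` carries the product
Lebesgue measure as `volume`; its built-in norm is the sup norm and is not used here.) -/
def normSqC {n : ℕ} (z : Fin n → ℂ) : ℝ := ∑ i, ‖z i‖ ^ 2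

/-- The (closed) cube `Q_r(z)` in `ℂⁿ = ℝ²ⁿ` with centre `z` and side length `r`. -/
def cube {n : ℕ} (r : ℝ) (z : Fin n → ℂ) : Set (Fin n → ℂ) :=
  {u | ∀ i, |(u i - z i).re| ≤ r / 2 ∧ |(u i - z i).im| ≤ r / 2}

/-- Weights: non-negative, locally integrable functions on `ℂⁿ` (local integrability includes
Lebesgue measurability). -/
structure IsWeight {n : ℕ} (w : (Fin n → ℂ) → ℝ) : Prop where
  nonneg : ∀ z, 0 ≤ w z
  locallyIntegrable : LocallyIntegrable w volume

/-- The class `A_p^restricted` for `1 < p < ∞`; here `p' = Real.conjExponent p = p / (p - 1)`. All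
integrals take values in `[0, ∞]`. -/
structure IsAResP {n : ℕ} (p : ℝ) (w : (Fin n → ℂ) → ℝ) : Prop where
  isWeight : IsWeight w
  pos : ∀ᵐ z, 0 < w z
  bounded : ∃ r : ℝ, 0 < r ∧
    (⨆ z : Fin n → ℂ,
      ((∫⁻ u in cube r z, ENNReal.ofReal (w u)) / volume (cube r z)) *
      ((∫⁻ u in cube r z, ENNReal.ofReal (w u) ^ (-(Real.conjExponent p / p))) /
        volume (cube r z)) ^ (p / Real.conjExponent p)) < ∞

/-- The class `A_1^restricted`. -/
structure IsAResOne {n : ℕ} (w : (Fin n → ℂ) → ℝ) : Prop where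
  isWeight : IsWeight w
  pos : ∀ᵐ z, 0 < w z
  bounded : ∃ r : ℝ, 0 < r ∧
    (⨆ z : Fin n → ℂ,
      (∫⁻ u in cube r z, ENNReal.ofReal (w u)) /
        (volume (cube r z) *
          essInf (fun u => ENNReal.ofReal (w u)) (volume.restrict (cube r z)))) < ∞

/-- The class `A_∞^restricted`, the union of the classes `A_p^restricted` over `1 ≤ p < ∞`. -/
def IsAResInfty {n : ℕ} (w : (Fin n → ℂ) → ℝ) : Prop :=
  IsAResOne w ∨ ∃ p : ℝ, 1 < p ∧ IsAResP p w

/-- The (quasi-)norm of `L^p_{α,w}`, with value `∞` off this space. -/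
def weightedNorm {n : ℕ} (p α : ℝ) (w : (Fin n → ℂ) → ℝ) (f : (Fin n → ℂ) → ℂ) : ℝ≥0∞ :=
  (∫⁻ z, ENNReal.ofReal (‖f z‖ ^ p * Real.exp (-(p * α / 2) * normSqC z) * w z)) ^ (1 / p)

/-- The weighted Fock space `F^p_{α,w}`: the entire functions in `L^p_{α,w}`. -/
def fockSpace {n : ℕ} (p α : ℝ) (w : (Fin n → ℂ) → ℝ) : Set ((Fin n → ℂ) → ℂ) :=
  {f | Differentiable ℂ f ∧ weightedNorm p α w f < ∞}

/-- The (quasi-)norm of `L^p_α(μ)`, with value `∞` off this space. -/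
def measureNorm {n : ℕ} (p α : ℝ) (μ : Measure (Fin n → ℂ)) (f : (Fin n → ℂ) → ℂ) : ℝ≥0∞ :=
  (∫⁻ z, ENNReal.ofReal (‖f z‖ ^ p * Real.exp (-(p * α / 2) * normSqC z)) ∂μ) ^ (1 / p)

/-- `μ` is a `q`-Carleson measure for `F^p_{α,w}`: the embedding of `F^p_{α,w}` into `L^q_α(μ)` is
well defined and bounded (the bound forces `measureNorm q α μ f < ∞` on `F^p_{α,w}`). -/
def IsCarleson {n : ℕ} (q p α : ℝ) (w : (Fin n → ℂ) → ℝ) (μ : Measure (Fin n → ℂ)) : Prop :=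
  ∃ C : ℝ, 0 < C ∧ ∀ f ∈ fockSpace p α w,
    measureNorm q α μ f ≤ ENNReal.ofReal C * weightedNorm p α w f

/-- `μ` is a `(w, lam)`-Fock–Carleson measure: it is a `q`-Carleson measure for `F^p_{α,w}` for some
positive `p`, `q`, `α` with `lam = q / p`. -/
def IsFockCarleson {n : ℕ} (w : (Fin n → ℂ) → ℝ) (lam : ℝ) (μ : Measure (Fin n → ℂ)) : Prop :=
  ∃ p q α : ℝ, 0 < p ∧ 0 < q ∧ 0 < α ∧ lam = q / p ∧ IsCarleson q p α w μ

/-- The multilinear embedding inequality with parameters `p_j`, `q_j`, `α_j`, `j = 1, …, k`. -/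
def ProductEmbedding {n k : ℕ} (w : (Fin n → ℂ) → ℝ) (μ : Measure (Fin n → ℂ))
    (p q α : Fin k → ℝ) : Prop :=
  ∃ C : ℝ, 0 < C ∧ ∀ f : Fin k → (Fin n → ℂ) → ℂ, (∀ j, f j ∈ fockSpace (p j) (α j) w) →
    ∫⁻ z, ENNReal.ofReal
        (∏ j, ‖f j z‖ ^ q j * Real.exp (-(q j * α j / 2) * normSqC z)) ∂μ ≤
      ENNReal.ofReal C * ∏ j, weightedNorm (p j) (α j) w (f j) ^ q j

end

/-!
The multilinear embedding inequality is equivalent to a discrete inequality in which the exponents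
`p_j`, `q_j`, `α_j` enter only through `lam = ∑ q_j / p_j`. Split `ℂⁿ` into the half-open cells
`P_m` of side `s = r / 2` of a lattice, where `r` is a radius for which the weight satisfies its
`A_p` condition, and write `W` for the measure with density `w`. The discrete inequality
(`CellEmbedding`) is
`∑ e_m ^ lam * μ(P_m) ≤ C * (∑ e_m * W(P_m)) ^ lam` for all finitely supported `e ≥ 0`.
Being a `(w, lam)`-Fock-Carleson measure is the case of one factor, so all three properties are
equivalent to it.

The weight enters through one consequence of the `A_p` condition (`CubeComparable`): for some
`θ > 0`, `∫_Q h ^ θ dv * W(Q) ^ θ ≤ C * (∫_Q h dW) ^ θ` for all cubes `Q` of side `r` and all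
`h ≥ 0`. With `h` an indicator function, this compares `W` on neighbouring cells, so that
`W(P_m)` varies at most exponentially in `m`. With `h` a power of `|f| e^{-α|z|²/2}`, and with the
sub-mean value property of `|f| ^ t` for every `t > 0`, it gives
`∑ W(P_m) * sup_{P_m} (|f| e^{-α|z|²/2}) ^ p ≤ C * ‖f‖ ^ p` for entire `f`
(`CubeComparable.exists_tsum_iSup_fockModulus_le`).

*The discrete inequality implies the embedding* (`CellEmbedding.productEmbedding`). Let `E_{j,m}` be
the supremum over `P_m` of `(|f_j| e^{-α_j|z|²/2}) ^ p_j`, and take for `e_m` the geometric mean of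
the `E_{j,m}` with weights `(q_j / p_j) / lam`; Hölder's inequality bounds `∑ e_m * W(P_m)`.

*The embedding implies the discrete inequality* (`ProductEmbedding.cellEmbedding`). Test it on
`f_j = ∑ ± e_m ^ (1 / p_j) * k_m`, where `k_m` is the normalized reproducing kernel at a point of
`P_m`. The Gaussian decay of `|k_m| e^{-α|z|²/2}` beats the exponential growth of `W`, hence
`‖f_j‖ ^ p_j ≤ C * ∑ e_m * W(P_m)` for every choice of signs. Averaging over independent signs for
the different `j` bounds `∏ |f_j| ^ q_j` below by its single terms, since
`|X + Y| ^ q + |X - Y| ^ q ≥ |Y| ^ q`; Khinchine's inequality is not needed.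
-/

noncomputable section

/-! ### Sub-mean value property of powers of entire functions -/

theorem enorm_le_lintegral_circleMap {f : ℂ → ℂ} (hf : Differentiable ℂ f) (c : ℂ) (r : ℝ) :
    ENNReal.ofReal (2 * Real.pi) * ‖f c‖ₑ ≤
      ∫⁻ θ in Set.Ioo (-Real.pi) Real.pi, ‖f (circleMap c r θ)‖ₑ := by
  have h := (hf.diffContOnCl (s := Metric.ball c |r|)).circleAverage
  rw [Real.circleAverage_eq_integral_add (-Real.pi)] at h
  have h2 : f c = (2 * Real.pi)⁻¹ • ∫ θ in Set.Ioo (-Real.pi) Real.pi, f (circleMap c r θ) := by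
    rw [← h, intervalIntegral.integral_comp_add_right (fun θ => f (circleMap c r θ)),
      intervalIntegral.integral_of_le (by linarith [Real.pi_pos]), integral_Ioc_eq_integral_Ioo]
    congr 4 <;> ring
  have h3 : ENNReal.ofReal (2 * Real.pi) * ‖f c‖ₑ
      = ‖∫ θ in Set.Ioo (-Real.pi) Real.pi, f (circleMap c r θ)‖ₑ := by
    rw [h2, ← ofReal_norm, ← ofReal_norm, ← ENNReal.ofReal_mul Real.two_pi_pos.le,
      norm_smul, Real.norm_of_nonneg (inv_nonneg.2 Real.two_pi_pos.le), ← mul_assoc,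
      mul_inv_cancel₀ Real.two_pi_pos.ne', one_mul]
  rw [h3]
  exact enorm_integral_le_lintegral_enorm _

/-- The mean value inequality on discs, with the constant `ρ²` in place of the optimal `π ρ²`. It
suffices to integrate over the annulus `ρ / 2 < |z - c| < ρ`. -/
theorem ofReal_sq_mul_enorm_le {f : ℂ → ℂ} (hf : Differentiable ℂ f) (c : ℂ) {ρ : ℝ}
    (hρ : 0 < ρ) :
    ENNReal.ofReal (ρ ^ 2) * ‖f c‖ₑ ≤ ∫⁻ z in Metric.closedBall c ρ, ‖f z‖ₑ := by
  have hmf : Measurable fun z => ‖f z‖ₑ := hf.continuous.enorm.measurable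
  have h1 : ∫⁻ z in Metric.closedBall c ρ, ‖f z‖ₑ
      = ∫⁻ z, (Metric.closedBall (0:ℂ) ρ).indicator (fun z => ‖f (c + z)‖ₑ) z := by
    rw [← lintegral_indicator Metric.isClosed_closedBall.measurableSet,
      ← lintegral_add_left_eq_self _ c]
    congr 1; ext z
    simp [Set.indicator]
  have hsub : Set.Ioo (ρ / 2) ρ ×ˢ Set.Ioo (-Real.pi) Real.pi ⊆ polarCoord.target := by
    rw [polarCoord_target]
    exact Set.prod_mono (fun x hx => (half_pos hρ).trans hx.1) le_rfl
  rw [h1, ← Complex.lintegral_comp_polarCoord_symm]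
  calc ENNReal.ofReal (ρ ^ 2) * ‖f c‖ₑ
      ≤ ∫⁻ r in Set.Ioo (ρ / 2) ρ, ENNReal.ofReal (ρ / 2) *
          (ENNReal.ofReal (2 * Real.pi) * ‖f c‖ₑ) := by
        rw [setLIntegral_const, Real.volume_Ioo, mul_comm _ (ENNReal.ofReal (ρ - ρ / 2)),
          ← mul_assoc, ← mul_assoc,
          ← ENNReal.ofReal_mul (by linarith), ← ENNReal.ofReal_mul (by nlinarith)]
        gcongr
        nlinarith [Real.pi_gt_three, sq_nonneg ρ]
    _ ≤ ∫⁻ r in Set.Ioo (ρ / 2) ρ, ∫⁻ θ in Set.Ioo (-Real.pi) Real.pi,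
          ENNReal.ofReal (ρ / 2) * ‖f (circleMap c r θ)‖ₑ := by
        refine lintegral_mono fun r => ?_
        rw [lintegral_const_mul _ (by
          exact hmf.comp (continuous_circleMap c r).measurable)]
        gcongr
        exact enorm_le_lintegral_circleMap hf c r
    _ = ∫⁻ p in Set.Ioo (ρ / 2) ρ ×ˢ Set.Ioo (-Real.pi) Real.pi,
          ENNReal.ofReal (ρ / 2) * ‖f (circleMap c p.1 p.2)‖ₑ := by
        rw [Measure.volume_eq_prod, setLIntegral_prod]
        refine Measurable.aemeasurable ?_
        refine Measurable.const_mul (hmf.comp ?_) _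
        unfold circleMap
        fun_prop
    _ ≤ _ := by
        refine le_trans ?_ (lintegral_mono_set hsub)
        refine setLIntegral_mono' (measurableSet_Ioo.prod measurableSet_Ioo) fun p hp => ?_
        have hp0 : 0 ≤ p.1 := (half_pos hρ).le.trans hp.1.1.le
        rw [Set.indicator_of_mem, smul_eq_mul]
        · gcongr
          · exact hp.1.1.le
          · rw [circleMap, Complex.polarCoord_symm_apply, Complex.exp_mul_I, Complex.ofReal_cos,
              Complex.ofReal_sin]
        · rw [mem_closedBall_zero_iff, Complex.norm_polarCoord_symm, abs_of_nonneg hp0]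
          exact hp.1.2.le

/-- Sub-mean value property of `|f| ^ t` for `0 < t ≤ 1`, after Hardy and Littlewood. Let `a`
maximize `(ρ - |z - c|) ^ (2 / t) * |f z|` on the disc, and apply the case `t = 1` on the disc about `a` of
radius half the distance to the boundary, on which `|f| ≤ 2 ^ (2 / t) * |f a|`. -/
theorem ofReal_sq_mul_enorm_rpow_le {f : ℂ → ℂ} (hf : Differentiable ℂ f) (c : ℂ) {ρ t : ℝ}
    (hρ : 0 < ρ) (ht : 0 < t) (ht1 : t ≤ 1) :
    ENNReal.ofReal (ρ ^ 2) * ‖f c‖ₑ ^ t ≤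
      ENNReal.ofReal (2 ^ (2 / t)) * ∫⁻ z in Metric.closedBall c ρ, ‖f z‖ₑ ^ t := by
  set K := 2 / t with hK
  have hKpos : 0 < K := by positivity
  have hKt : K * t = 2 := by rw [hK]; field_simp
  obtain ⟨a, haD, hmax⟩ := (isCompact_closedBall c ρ).exists_isMaxOn
    (f := fun z => (ρ - dist z c) ^ K * ‖f z‖) ⟨c, Metric.mem_closedBall_self hρ.le⟩
    (by
      refine ContinuousOn.mul (ContinuousOn.rpow_const (by fun_prop) fun _ _ => Or.inr hKpos.le)
        hf.continuous.norm.continuousOn)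
  set d := ρ - dist a c with hd
  have hd0 : 0 ≤ d := by rw [hd]; linarith [Metric.mem_closedBall.1 haD]
  have hmax' : ∀ z ∈ Metric.closedBall c ρ, (ρ - dist z c) ^ K * ‖f z‖ ≤ d ^ K * ‖f a‖ :=
    fun z hz => hmax hz
  have hc := hmax' c (Metric.mem_closedBall_self hρ.le)
  rw [dist_self, sub_zero] at hc
  have hpow : ∀ x y : ℝ, 0 ≤ x → 0 ≤ y → (x ^ K * y) ^ t = x ^ 2 * y ^ t := by
    intro x y hx hy
    rw [Real.mul_rpow (by positivity) hy, ← Real.rpow_mul hx, hKt, Real.rpow_two]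
  have hc2 : ρ ^ 2 * ‖f c‖ ^ t ≤ d ^ 2 * ‖f a‖ ^ t := by
    rw [← hpow _ _ hρ.le (norm_nonneg _), ← hpow _ _ hd0 (norm_nonneg _)]
    gcongr
  have henorm : ∀ z, ‖f z‖ₑ ^ t = ENNReal.ofReal (‖f z‖ ^ t) := fun z => by
    rw [← ofReal_norm, ENNReal.ofReal_rpow_of_nonneg (norm_nonneg _) ht.le]
  rw [henorm c, ← ENNReal.ofReal_mul (sq_nonneg _)]
  refine (ENNReal.ofReal_le_ofReal hc2).trans ?_
  rcases hd0.eq_or_lt with hd0 | hdpos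
  · simp [← hd0]
  rcases (norm_nonneg (f a)).eq_or_lt with ha0 | hapos
  · simp [← ha0, Real.zero_rpow ht.ne']
  -- on the disc of radius `d / 2` about the maximum point, `‖f‖` is at most `2 ^ K * ‖f a‖`
  have hball : Metric.closedBall a (d / 2) ⊆ Metric.closedBall c ρ := by
    refine Metric.closedBall_subset_closedBall' ?_
    linarith
  have hbd : ∀ z ∈ Metric.closedBall a (d / 2), ‖f z‖ ≤ 2 ^ K * ‖f a‖ := by
    intro z hz
    have h1 := hmax' z (hball hz)
    have h2 : d / 2 ≤ ρ - dist z c := by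
      have := dist_triangle z a c
      have := Metric.mem_closedBall.1 hz
      linarith
    have h3 : (d / 2) ^ K * ‖f z‖ ≤ d ^ K * ‖f a‖ := le_trans (by gcongr) h1
    rw [Real.div_rpow hdpos.le zero_le_two] at h3
    have h4 : (0:ℝ) < 2 ^ K := by positivity
    have h5 : 0 < d ^ K := by positivity
    rw [div_mul_eq_mul_div, div_le_iff₀ h4, mul_assoc] at h3
    have := le_of_mul_le_mul_left h3 h5
    linarith
  have h6 : ENNReal.ofReal ((d / 2) ^ 2) * ‖f a‖ₑ ≤
      ENNReal.ofReal ((2 ^ K * ‖f a‖) ^ (1 - t)) *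
        ∫⁻ z in Metric.closedBall c ρ, ‖f z‖ₑ ^ t := by
    refine (ofReal_sq_mul_enorm_le hf a (half_pos hdpos)).trans ?_
    rw [← lintegral_const_mul _ (hf.continuous.enorm.measurable.pow_const t)]
    refine le_trans ?_ (lintegral_mono_set hball)
    refine setLIntegral_mono' Metric.isClosed_closedBall.measurableSet fun z hz => ?_
    rw [henorm, ← ENNReal.ofReal_mul (by positivity), ← ofReal_norm]
    refine ENNReal.ofReal_le_ofReal ?_
    rcases (norm_nonneg (f z)).eq_or_lt with h0 | h0
    · rw [← h0]; positivity
    calc ‖f z‖ = ‖f z‖ ^ (1 - t) * ‖f z‖ ^ t := by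
          rw [← Real.rpow_add h0, sub_add_cancel, Real.rpow_one]
      _ ≤ _ := by
          gcongr
          exact hbd z hz
  generalize (∫⁻ z in Metric.closedBall c ρ, ‖f z‖ₑ ^ t) = J at h6 ⊢
  rcases eq_or_ne J ∞ with rfl | hJ
  · rw [ENNReal.mul_top (by simpa using by positivity)]; exact le_top
  lift J to NNReal using hJ
  rw [← ofReal_norm, ← ENNReal.ofReal_mul (by positivity), ← ENNReal.ofReal_coe_nnreal,
    ← ENNReal.ofReal_mul (by positivity), ENNReal.ofReal_le_ofReal_iff (by positivity)] at h6
  rw [← ENNReal.ofReal_coe_nnreal, ← ENNReal.ofReal_mul (by positivity)]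
  refine ENNReal.ofReal_le_ofReal ?_
  rw [Real.mul_rpow (by positivity) hapos.le, ← Real.rpow_mul zero_le_two,
    mul_sub, hKt, mul_one, Real.rpow_sub zero_lt_two] at h6
  have h7 : ‖f a‖ = ‖f a‖ ^ (1 - t) * ‖f a‖ ^ t := by
    rw [← Real.rpow_add hapos, sub_add_cancel, Real.rpow_one]
  have h8 : 0 < ‖f a‖ ^ (1 - t) := by positivity
  have h9 : ‖f a‖ ^ (1 - t) * (d ^ 2 * ‖f a‖ ^ t) ≤ ‖f a‖ ^ (1 - t) * (2 ^ K * J) := by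
    have e1 : (2:ℝ) ^ (2:ℝ) = 4 := by norm_num
    rw [e1] at h6
    calc _ = 4 * ((d / 2) ^ 2 * (‖f a‖ ^ (1 - t) * ‖f a‖ ^ t)) := by ring
      _ ≤ 4 * (2 ^ K / 4 * ‖f a‖ ^ (1 - t) * J) := by rw [← h7]; gcongr
      _ = _ := by ring
  exact le_of_mul_le_mul_left h9 h8

/-- Sub-mean value property of `|f| ^ t` on discs; exponents `t > 1` follow from `t = 1` by Hölder's
inequality. -/
theorem exists_enorm_rpow_le_lintegral_closedBall {t ρ : ℝ} (ht : 0 < t) (hρ : 0 < ρ) :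
    ∃ C : ℝ≥0∞, C ≠ ∞ ∧ ∀ f : ℂ → ℂ, Differentiable ℂ f → ∀ c : ℂ,
      ‖f c‖ₑ ^ t ≤ C * ∫⁻ z in Metric.closedBall c ρ, ‖f z‖ₑ ^ t := by
  have hρ2 : ENNReal.ofReal (ρ ^ 2) ≠ 0 := by simpa using by positivity
  have key : ∀ s : ℝ, 0 < s → s ≤ 1 → ∀ f : ℂ → ℂ, Differentiable ℂ f → ∀ c : ℂ,
      ‖f c‖ₑ ^ s ≤ (ENNReal.ofReal (2 ^ (2 / s)) / ENNReal.ofReal (ρ ^ 2)) *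
        ∫⁻ z in Metric.closedBall c ρ, ‖f z‖ₑ ^ s := by
    intro s hs hs1 f hf c
    rw [ENNReal.mul_comm_div, ← mul_div_assoc, ENNReal.le_div_iff_mul_le (Or.inl hρ2)
      (Or.inl ENNReal.ofReal_ne_top), mul_comm]
    exact ofReal_sq_mul_enorm_rpow_le hf c hρ hs hs1
  rcases le_or_gt t 1 with ht1 | ht1
  · exact ⟨_, ENNReal.div_ne_top ENNReal.ofReal_ne_top hρ2, key t ht ht1⟩
  have hpq := Real.HolderConjugate.conjExponent ht1
  set q := Real.conjExponent t
  set A := ENNReal.ofReal (2 ^ (2 / (1:ℝ))) / ENNReal.ofReal (ρ ^ 2) with hA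
  have hAtop : A ≠ ∞ := ENNReal.div_ne_top ENNReal.ofReal_ne_top hρ2
  set V := volume (Metric.closedBall (0:ℂ) ρ)
  have hV : V ≠ ∞ := measure_closedBall_lt_top.ne
  refine ⟨(A * V ^ (1 / q)) ^ t, ENNReal.rpow_ne_top_of_nonneg ht.le
    (ENNReal.mul_ne_top hAtop (ENNReal.rpow_ne_top_of_nonneg hpq.symm.one_div_nonneg hV)), ?_⟩
  intro f hf c
  have h1 := key 1 one_pos le_rfl f hf c
  simp only [ENNReal.rpow_one] at h1
  have h2 := ENNReal.lintegral_mul_le_Lp_mul_Lq (volume.restrict (Metric.closedBall c ρ)) hpq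
    (f := fun z => ‖f z‖ₑ) (g := fun _ => 1) hf.continuous.enorm.measurable.aemeasurable
    aemeasurable_const
  simp only [Pi.mul_apply, mul_one, ENNReal.one_rpow, setLIntegral_const, one_mul] at h2
  rw [show volume (Metric.closedBall c ρ) = V by
    simp only [V, Complex.volume_closedBall]] at h2
  calc ‖f c‖ₑ ^ t ≤ (A * ((∫⁻ z in Metric.closedBall c ρ, ‖f z‖ₑ ^ t) ^ (1 / t)
        * V ^ (1 / q))) ^ t := by
        gcongr
        exact h1.trans (by gcongr)
    _ = _ := by
        rw [mul_comm (_ ^ (1 / t)), ← mul_assoc, ENNReal.mul_rpow_of_nonneg _ _ ht.le,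
          ← ENNReal.rpow_mul _ (1 / t), one_div_mul_cancel ht.ne', ENNReal.rpow_one]

/-- Sub-mean value property on polydiscs, which are the closed balls of the sup norm; one variable
is treated at a time. -/
theorem exists_enorm_rpow_le_lintegral_closedBall_pi {t ρ : ℝ} (ht : 0 < t) (hρ : 0 < ρ) (n : ℕ) :
    ∃ C : ℝ≥0∞, C ≠ ∞ ∧ ∀ f : (Fin n → ℂ) → ℂ, Differentiable ℂ f → ∀ c : Fin n → ℂ,
      ‖f c‖ₑ ^ t ≤ C * ∫⁻ z in Metric.closedBall c ρ, ‖f z‖ₑ ^ t := by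
  obtain ⟨A, hA, h1⟩ := exists_enorm_rpow_le_lintegral_closedBall ht hρ
  induction n with
  | zero =>
    refine ⟨1, ENNReal.one_ne_top, fun f hf c => ?_⟩
    rw [show Metric.closedBall c ρ = Set.univ from Set.eq_univ_of_forall fun z => by
      rw [Subsingleton.elim z c]; exact Metric.mem_closedBall_self hρ.le]
    simp [volume_pi, Measure.pi_of_empty _ c]
  | succ n ih =>
    obtain ⟨C, hC, ih⟩ := ih
    refine ⟨A * C, ENNReal.mul_ne_top hA hC, fun f hf c => ?_⟩
    have hmf : Measurable fun z => ‖f z‖ₑ ^ t := hf.continuous.enorm.measurable.pow_const t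
    have hcons : Differentiable ℂ fun p : ℂ × (Fin n → ℂ) =>
        (Fin.cons p.1 p.2 : Fin (n + 1) → ℂ) := by
      refine differentiable_pi.2 fun i => ?_
      refine Fin.cases ?_ (fun j => ?_) i
      · simp
      · simp only [Fin.cons_succ]
        fun_prop
    have hmc : Measurable fun p : ℂ × (Fin n → ℂ) => (Fin.cons p.1 p.2 : Fin (n + 1) → ℂ) :=
      hcons.continuous.measurable
    have e : ∫⁻ z in Metric.closedBall c ρ, ‖f z‖ₑ ^ t =
        ∫⁻ x in Metric.closedBall (c 0) ρ, ∫⁻ y in Metric.closedBall (Fin.tail c) ρ,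
          ‖f (Fin.cons x y)‖ₑ ^ t := by
      have hmp := (volume_preserving_piFinSuccAbove (fun _ : Fin (n + 1) => ℂ) 0).symm
      rw [← hmp.setLIntegral_comp_preimage Metric.isClosed_closedBall.measurableSet hmf]
      have hsymm : ∀ (x : ℂ) (y : Fin n → ℂ),
          (MeasurableEquiv.piFinSuccAbove (fun _ : Fin (n + 1) => ℂ) 0).symm (x, y)
            = (Fin.cons x y : Fin (n + 1) → ℂ) :=
        fun x y => funext fun i => Fin.cases rfl (fun _ => rfl) i
      have hset : (MeasurableEquiv.piFinSuccAbove (fun _ : Fin (n + 1) => ℂ) 0).symm ⁻¹'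
          Metric.closedBall c ρ
          = Metric.closedBall (c 0) ρ ×ˢ Metric.closedBall (Fin.tail c) ρ := by
        ext p
        simp only [Set.mem_preimage, Set.mem_prod, closedBall_pi _ hρ.le, Set.mem_univ_pi,
          Fin.forall_fin_succ]
        rfl
      rw [hset, Measure.volume_eq_prod, setLIntegral_prod]
      · simp only [hsymm]
      · exact (hmf.comp (MeasurableEquiv.measurable _)).aemeasurable
    rw [e]
    calc ‖f c‖ₑ ^ t = ‖f (Fin.cons (c 0) (Fin.tail c))‖ₑ ^ t := by rw [Fin.cons_self_tail]
      _ ≤ A * ∫⁻ x in Metric.closedBall (c 0) ρ, ‖f (Fin.cons x (Fin.tail c))‖ₑ ^ t :=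
          h1 (fun x => f (Fin.cons x (Fin.tail c)))
            (hf.comp (hcons.comp (differentiable_id.prodMk (differentiable_const _)))) _
      _ ≤ A * ∫⁻ x in Metric.closedBall (c 0) ρ, C *
            ∫⁻ y in Metric.closedBall (Fin.tail c) ρ, ‖f (Fin.cons x y)‖ₑ ^ t := by
          gcongr with x
          exact ih (fun y => f (Fin.cons x y))
            (hf.comp (hcons.comp ((differentiable_const _).prodMk differentiable_id))) _
      _ = _ := by
          rw [lintegral_const_mul, mul_assoc]
          exact (hmf.comp hmc).lintegral_prod_right'

/-! ### The modulus of an entire function with its Gaussian factor -/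

/-- The function `|f| e^{-α|z|²/2}`, with values in `[0, ∞]`. -/
def fockModulus {n : ℕ} (α : ℝ) (f : (Fin n → ℂ) → ℂ) (z : Fin n → ℂ) : ℝ≥0∞ :=
  ENNReal.ofReal (‖f z‖ * Real.exp (-(α / 2) * normSqC z))

@[fun_prop]
theorem continuous_normSqC {n : ℕ} : Continuous (normSqC (n := n)) := by
  unfold normSqC; fun_prop

theorem continuous_fockModulus {n : ℕ} (α : ℝ) {f : (Fin n → ℂ) → ℂ} (hf : Continuous f) :
    Continuous (fockModulus α f) := by
  unfold fockModulus
  exact ENNReal.continuous_ofReal.comp (by fun_prop)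

theorem fockModulus_rpow {n : ℕ} {q : ℝ} (hq : 0 ≤ q) (α : ℝ) (f : (Fin n → ℂ) → ℂ)
    (z : Fin n → ℂ) :
    fockModulus α f z ^ q
      = ENNReal.ofReal (‖f z‖ ^ q * Real.exp (-(q * α / 2) * normSqC z)) := by
  rw [fockModulus, ENNReal.ofReal_rpow_of_nonneg (by positivity) hq,
    Real.mul_rpow (norm_nonneg _) (Real.exp_nonneg _), ← Real.exp_mul]
  congr 3; ring

/-- Multiplication of `f` by a zero-free entire function recentres the Gaussian factor at `a`. -/
theorem norm_mul_exp_eq {n : ℕ} (α : ℝ) (f : (Fin n → ℂ) → ℂ) (a z : Fin n → ℂ) :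
    ‖f z * Complex.exp (α * (normSqC a / 2 - ∑ i, z i * star (a i)))‖
      = ‖f z‖ * Real.exp (-(α / 2) * normSqC z) * Real.exp (α / 2 * normSqC (z - a)) := by
  rw [norm_mul, Complex.norm_exp, mul_assoc, ← Real.exp_add]
  congr 2
  have h : normSqC (z - a) = normSqC z + normSqC a - 2 * (∑ i, z i * star (a i)).re := by
    simp only [normSqC, Complex.re_sum, Finset.mul_sum, ← Finset.sum_add_distrib,
      ← Finset.sum_sub_distrib]
    refine Finset.sum_congr rfl fun i _ => ?_
    simp only [← Complex.normSq_eq_norm_sq, Complex.normSq_apply, Pi.sub_apply, Complex.sub_re,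
      Complex.sub_im, Complex.mul_re, Complex.star_def, Complex.conj_re, Complex.conj_im]
    ring
  rw [h, ← Complex.ofReal_ofNat, ← Complex.ofReal_div, Complex.re_ofReal_mul, Complex.sub_re,
    Complex.ofReal_re]
  ring

/-- Sub-mean value property of `(|f| e^{-α|z|²/2}) ^ t`: recentred at `a`, the Gaussian factor is
bounded above and below on the polydisc. -/
theorem exists_fockModulus_rpow_le {t ρ α : ℝ} (ht : 0 < t) (hρ : 0 < ρ) (hα : 0 < α) (n : ℕ) :
    ∃ C : ℝ≥0∞, C ≠ ∞ ∧ ∀ f : (Fin n → ℂ) → ℂ, Differentiable ℂ f → ∀ a : Fin n → ℂ,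
      fockModulus α f a ^ t ≤ C * ∫⁻ z in Metric.closedBall a ρ, fockModulus α f z ^ t := by
  obtain ⟨C, hC, h⟩ := exists_enorm_rpow_le_lintegral_closedBall_pi ht hρ n
  set E := ENNReal.ofReal (Real.exp (α / 2 * (n * ρ ^ 2))) with hE
  refine ⟨C * E ^ t, ENNReal.mul_ne_top hC (ENNReal.rpow_ne_top_of_nonneg ht.le
    ENNReal.ofReal_ne_top), fun f hf a => ?_⟩
  set g : (Fin n → ℂ) → ℂ :=
    fun z => f z * Complex.exp (α * (normSqC a / 2 - ∑ i, z i * star (a i))) with hg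
  have hgd : Differentiable ℂ g := by rw [hg]; fun_prop
  have hga : ‖g a‖ₑ = fockModulus α f a := by
    rw [← ofReal_norm, hg]
    simp only [norm_mul_exp_eq]
    simp [fockModulus, normSqC]
  have hgz : ∀ z ∈ Metric.closedBall a ρ, ‖g z‖ₑ ^ t ≤ E ^ t * fockModulus α f z ^ t := by
    intro z hz
    rw [← ENNReal.mul_rpow_of_nonneg _ _ ht.le]
    gcongr
    rw [← ofReal_norm, hg]
    simp only [norm_mul_exp_eq]
    rw [fockModulus, hE, ← ENNReal.ofReal_mul (by positivity), mul_comm (Real.exp (α / 2 * _))]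
    gcongr
    calc normSqC (z - a) ≤ ∑ _i : Fin n, ρ ^ 2 := by
          refine Finset.sum_le_sum fun i _ => ?_
          gcongr
          exact (norm_le_pi_norm (z - a) i).trans (mem_closedBall_iff_norm.1 hz)
      _ = _ := by simp
  rw [← hga]
  refine (h g hgd a).trans ?_
  rw [mul_assoc, ← lintegral_const_mul _
    ((continuous_fockModulus α hf.continuous).measurable.pow_const t)]
  exact mul_le_mul' le_rfl (setLIntegral_mono' Metric.isClosed_closedBall.measurableSet hgz)

/-! ### Cubes and the measure of a weight -/

theorem cube_eq_preimage {n : ℕ} (r : ℝ) (z : Fin n → ℂ) :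
    cube r z = (fun u => u + -z) ⁻¹' cube r 0 := by
  ext u; simp [cube, sub_eq_add_neg]

theorem isClosed_cube {n : ℕ} (r : ℝ) (z : Fin n → ℂ) : IsClosed (cube r z) := by
  simp only [cube, Set.ofPred_forall, Set.ofPred_and]
  exact isClosed_iInter fun i => (isClosed_le (by fun_prop) (by fun_prop)).inter
    (isClosed_le (by fun_prop) (by fun_prop))

theorem closedBall_subset_cube {n : ℕ} (r : ℝ) (z : Fin n → ℂ) :
    Metric.closedBall z (r / 2) ⊆ cube r z := fun u hu i => by
  have h := (norm_le_pi_norm (u - z) i).trans (mem_closedBall_iff_norm.1 hu)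
  exact ⟨(Complex.abs_re_le_norm _).trans h, (Complex.abs_im_le_norm _).trans h⟩

theorem cube_subset_closedBall {n : ℕ} {r : ℝ} (hr : 0 ≤ r) (z : Fin n → ℂ) :
    cube r z ⊆ Metric.closedBall z r := fun u hu => by
  rw [mem_closedBall_iff_norm, pi_norm_le_iff_of_nonneg hr]
  intro i
  have h := Complex.norm_le_abs_re_add_abs_im (u i - z i)
  have := hu i
  rw [Pi.sub_apply]
  linarith

theorem isCompact_cube {n : ℕ} {r : ℝ} (hr : 0 ≤ r) (z : Fin n → ℂ) : IsCompact (cube r z) :=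
  (isCompact_closedBall z r).of_isClosed_subset (isClosed_cube r z) (cube_subset_closedBall hr z)

theorem volume_cube {n : ℕ} (r : ℝ) (z : Fin n → ℂ) :
    volume (cube r z) = volume (cube r (0 : Fin n → ℂ)) := by
  rw [cube_eq_preimage, measure_preimage_add_right]

theorem volume_cube_pos {n : ℕ} {r : ℝ} (hr : 0 < r) (z : Fin n → ℂ) : 0 < volume (cube r z) :=
  (Metric.measure_closedBall_pos volume z (half_pos hr)).trans_le
    (measure_mono (closedBall_subset_cube r z))

theorem volume_cube_ne_top {n : ℕ} {r : ℝ} (hr : 0 ≤ r) (z : Fin n → ℂ) :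
    volume (cube r z) ≠ ∞ := (isCompact_cube hr z).measure_lt_top.ne

/-- The measure `w dv`. -/
def weightMeasure {n : ℕ} (w : (Fin n → ℂ) → ℝ) : Measure (Fin n → ℂ) :=
  volume.withDensity fun z => ENNReal.ofReal (w z)

theorem IsWeight.aemeasurable {n : ℕ} {w : (Fin n → ℂ) → ℝ} (hw : IsWeight w) :
    AEMeasurable (fun z => ENNReal.ofReal (w z)) :=
  hw.locallyIntegrable.aestronglyMeasurable.aemeasurable.ennreal_ofReal

theorem weightMeasure_cube {n : ℕ} (w : (Fin n → ℂ) → ℝ) (r : ℝ) (z : Fin n → ℂ) :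
    weightMeasure w (cube r z) = ∫⁻ u in cube r z, ENNReal.ofReal (w u) :=
  withDensity_apply _ (isClosed_cube r z).measurableSet

theorem weightMeasure_cube_lt_top {n : ℕ} {w : (Fin n → ℂ) → ℝ} (hw : IsWeight w) {r : ℝ}
    (hr : 0 ≤ r) (z : Fin n → ℂ) : weightMeasure w (cube r z) < ∞ := by
  rw [weightMeasure_cube]
  have h := (hw.locallyIntegrable.integrableOn_isCompact (isCompact_cube hr z))
  have := h.2
  simpa [HasFiniteIntegral, Real.enorm_eq_ofReal (hw.nonneg _)] using this

theorem lintegral_weightMeasure {n : ℕ} {w : (Fin n → ℂ) → ℝ} (hw : IsWeight w)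
    {h : (Fin n → ℂ) → ℝ≥0∞} (hh : Measurable h) :
    ∫⁻ z, h z ∂weightMeasure w = ∫⁻ z, ENNReal.ofReal (w z) * h z :=
  lintegral_withDensity_eq_lintegral_mul₀ hw.aemeasurable hh.aemeasurable

theorem setLIntegral_weightMeasure {n : ℕ} {w : (Fin n → ℂ) → ℝ} (hw : IsWeight w)
    {h : (Fin n → ℂ) → ℝ≥0∞} (hh : Measurable h) {s : Set (Fin n → ℂ)} (hs : MeasurableSet s) :
    ∫⁻ z in s, h z ∂weightMeasure w = ∫⁻ z in s, ENNReal.ofReal (w z) * h z := by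
  rw [weightMeasure, restrict_withDensity hs]
  exact lintegral_withDensity_eq_lintegral_mul₀ hw.aemeasurable.restrict hh.aemeasurable

/-- The reverse Hölder-type comparison of `ν` with Lebesgue measure on cubes of side `r` that the
restricted `A_p` condition provides, with `θ = 1 / p`. It is stated without division, so that no
positivity of `ν` is required. -/
def CubeComparable {n : ℕ} (ν : Measure (Fin n → ℂ)) (r θ : ℝ) (C : ℝ≥0∞) : Prop :=
  ∀ (z : Fin n → ℂ) (h : (Fin n → ℂ) → ℝ≥0∞), Measurable h →
    (∫⁻ u in cube r z, h u ^ θ) * ν (cube r z) ^ θ ≤ C * (∫⁻ u in cube r z, h u ∂ν) ^ θ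

theorem IsAResOne.exists_cubeComparable {n : ℕ} {w : (Fin n → ℂ) → ℝ} (hw : IsAResOne w) :
    ∃ r : ℝ, 0 < r ∧ ∃ C : ℝ≥0∞, C ≠ ∞ ∧ CubeComparable (weightMeasure w) r 1 C := by
  obtain ⟨r, hr, hB⟩ := hw.bounded
  refine ⟨r, hr, _ * volume (cube r (0 : Fin n → ℂ)),
    ENNReal.mul_ne_top hB.ne (volume_cube_ne_top hr.le _), fun z h hh => ?_⟩
  have h1 := le_iSup (fun z : Fin n → ℂ => (∫⁻ u in cube r z, ENNReal.ofReal (w u)) /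
        (volume (cube r z) *
          essInf (fun u => ENNReal.ofReal (w u)) (volume.restrict (cube r z)))) z
  set B := ⨆ z : Fin n → ℂ, (∫⁻ u in cube r z, ENNReal.ofReal (w u)) /
        (volume (cube r z) *
          essInf (fun u => ENNReal.ofReal (w u)) (volume.restrict (cube r z)))
  set m := essInf (fun u => ENNReal.ofReal (w u)) (volume.restrict (cube r z)) with hm
  have hle : ∀ᵐ u ∂volume.restrict (cube r z), m ≤ ENNReal.ofReal (w u) := ae_essInf_le
  have hmW : m * volume (cube r z) ≤ weightMeasure w (cube r z) := by
    rw [weightMeasure_cube, ← setLIntegral_const]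
    exact lintegral_mono_ae hle
  have hmtop : volume (cube r z) * m ≠ ∞ := by
    rw [mul_comm]; exact (hmW.trans_lt (weightMeasure_cube_lt_top hw.isWeight hr.le z)).ne
  have hW : weightMeasure w (cube r z) ≤ B * (volume (cube r z) * m) := by
    rw [weightMeasure_cube]
    exact (ENNReal.div_le_iff_le_mul (Or.inr hB.ne) (Or.inl hmtop)).1 h1
  simp only [ENNReal.rpow_one]
  calc (∫⁻ u in cube r z, h u) * weightMeasure w (cube r z)
      ≤ (∫⁻ u in cube r z, h u) * (B * (volume (cube r z) * m)) := by gcongr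
    _ = B * volume (cube r (0 : Fin n → ℂ)) * (m * ∫⁻ u in cube r z, h u) := by
        rw [volume_cube r z]; ring
    _ ≤ B * volume (cube r (0 : Fin n → ℂ)) * ∫⁻ u in cube r z, h u ∂weightMeasure w := by
        rw [setLIntegral_weightMeasure hw.isWeight hh (isClosed_cube r z).measurableSet,
          ← lintegral_const_mul _ hh]
        gcongr 1
        refine lintegral_mono_ae ?_
        filter_upwards [hle] with u hu
        gcongr

/-- Apply Hölder's inequality to `h ^ (1 / p) = (h * w) ^ (1 / p) * w ^ (-1 / p)`. -/
theorem IsAResP.exists_cubeComparable {n : ℕ} {w : (Fin n → ℂ) → ℝ} {p : ℝ} (hp : 1 < p)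
    (hw : IsAResP p w) :
    ∃ r : ℝ, 0 < r ∧ ∃ C : ℝ≥0∞, C ≠ ∞ ∧ CubeComparable (weightMeasure w) r (1 / p) C := by
  obtain ⟨r, hr, hB⟩ := hw.bounded
  have hpq := Real.HolderConjugate.conjExponent hp
  set q := Real.conjExponent p
  have hp0 := hpq.pos
  have hq0 := hpq.symm.pos
  set B := ⨆ z : Fin n → ℂ,
      ((∫⁻ u in cube r z, ENNReal.ofReal (w u)) / volume (cube r z)) *
      ((∫⁻ u in cube r z, ENNReal.ofReal (w u) ^ (-(q / p))) /
        volume (cube r z)) ^ (p / q)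
  set V := volume (cube r (0 : Fin n → ℂ)) with hV
  have hV0 : V ≠ 0 := (volume_cube_pos hr _).ne'
  have hVtop : V ≠ ∞ := volume_cube_ne_top hr.le _
  refine ⟨r, hr, (B * V * V ^ (p / q)) ^ (1 / p), ?_, fun z h hh => ?_⟩
  · refine ENNReal.rpow_ne_top_of_nonneg (by positivity) (ENNReal.mul_ne_top
      (ENNReal.mul_ne_top hB.ne hVtop) (ENNReal.rpow_ne_top_of_nonneg (by positivity) hVtop))
  have h1 := le_iSup (fun z : Fin n → ℂ =>
      ((∫⁻ u in cube r z, ENNReal.ofReal (w u)) / volume (cube r z)) *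
      ((∫⁻ u in cube r z, ENNReal.ofReal (w u) ^ (-(q / p))) /
        volume (cube r z)) ^ (p / q)) z
  change _ ≤ B at h1
  simp only [← weightMeasure_cube, volume_cube r z, ← hV] at h1
  set S := ∫⁻ u in cube r z, ENNReal.ofReal (w u) ^ (-(q / p)) with hS
  set W := weightMeasure w (cube r z) with hW
  have h2 : W * S ^ (p / q) ≤ B * V * V ^ (p / q) := by
    have hVp0 : V ^ (p / q) ≠ 0 := (ENNReal.rpow_pos (pos_iff_ne_zero.2 hV0) hVtop).ne'
    have hVptop : V ^ (p / q) ≠ ∞ := ENNReal.rpow_ne_top_of_nonneg (by positivity) hVtop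
    calc W * S ^ (p / q) = (W / V * V) * ((S / V) ^ (p / q) * V ^ (p / q)) := by
          rw [ENNReal.div_mul_cancel hV0 hVtop, ← ENNReal.mul_rpow_of_nonneg _ _ (by positivity),
            ENNReal.div_mul_cancel hV0 hVtop]
      _ = (W / V * (S / V) ^ (p / q)) * V * V ^ (p / q) := by ring
      _ ≤ _ := by gcongr
  have hwm := hw.isWeight.aemeasurable
  have h3 : ∫⁻ u in cube r z, h u ^ (1 / p) ≤
      (∫⁻ u in cube r z, h u ∂weightMeasure w) ^ (1 / p) * S ^ (1 / q) := by
    rw [setLIntegral_weightMeasure hw.isWeight hh (isClosed_cube r z).measurableSet]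
    have := ENNReal.lintegral_mul_le_Lp_mul_Lq (volume.restrict (cube r z)) hpq
      (f := fun u => (ENNReal.ofReal (w u) * h u) ^ (1 / p))
      (g := fun u => ENNReal.ofReal (w u) ^ (-(1 / p)))
      ((hwm.restrict.mul hh.aemeasurable).pow_const _) (hwm.restrict.pow_const _)
    simp only [← ENNReal.rpow_mul, one_div_mul_cancel hp0.ne', ENNReal.rpow_one] at this
    refine (le_of_eq (lintegral_congr_ae ?_)).trans (this.trans (le_of_eq ?_))
    · filter_upwards [ae_restrict_of_ae hw.pos] with u hu
      simp only [Pi.mul_apply]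
      rw [ENNReal.mul_rpow_of_nonneg _ _ (by positivity), mul_right_comm,
        ← ENNReal.rpow_add _ _ (by simpa using hu) ENNReal.ofReal_ne_top]
      simp
    · congr 3
      funext u
      congr 1; ring
  calc (∫⁻ u in cube r z, h u ^ (1 / p)) * W ^ (1 / p)
      ≤ ((∫⁻ u in cube r z, h u ∂weightMeasure w) ^ (1 / p) * S ^ (1 / q)) * W ^ (1 / p) := by
        gcongr
    _ = (W * S ^ (p / q)) ^ (1 / p) * (∫⁻ u in cube r z, h u ∂weightMeasure w) ^ (1 / p) := by
        rw [ENNReal.mul_rpow_of_nonneg _ _ (by positivity), ← ENNReal.rpow_mul,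
          show p / q * (1 / p) = 1 / q by field_simp]
        ring
    _ ≤ _ := by gcongr

theorem IsAResInfty.exists_cubeComparable {n : ℕ} {w : (Fin n → ℂ) → ℝ} (hw : IsAResInfty w) :
    IsWeight w ∧ ∃ r θ : ℝ, 0 < r ∧ 0 < θ ∧
      ∃ C : ℝ≥0∞, C ≠ ∞ ∧ CubeComparable (weightMeasure w) r θ C := by
  rcases hw with hw | ⟨p, hp, hw⟩
  · obtain ⟨r, hr, C, hC, h⟩ := hw.exists_cubeComparable
    exact ⟨hw.isWeight, r, 1, hr, one_pos, C, hC, h⟩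
  · obtain ⟨r, hr, C, hC, h⟩ := hw.exists_cubeComparable hp
    exact ⟨hw.isWeight, r, 1 / p, hr, by positivity, C, hC, h⟩

/-! ### The lattice of cells -/

/-- The index of the half-open cell of side `s` that contains `z`; real and imaginary parts of the
coordinates are indexed by pairs of integers. -/
def cellIndex {n : ℕ} (s : ℝ) (z : Fin n → ℂ) : Fin n → ℤ × ℤ :=
  fun i => (⌊(z i).re / s⌋, ⌊(z i).im / s⌋)

/-- The half-open cell with index `m`. The cells of side `s` partition `ℂⁿ`. -/
def cell {n : ℕ} (s : ℝ) (m : Fin n → ℤ × ℤ) : Set (Fin n → ℂ) := cellIndex s ⁻¹' {m}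

/-- The corner of the cell with index `m` at which all coordinates are smallest. -/
def latticePoint {n : ℕ} (s : ℝ) (m : Fin n → ℤ × ℤ) : Fin n → ℂ :=
  fun i => ⟨s * (m i).1, s * (m i).2⟩

/-- The centre of the cell with index `m`. -/
def cellCenter {n : ℕ} (s : ℝ) (m : Fin n → ℤ × ℤ) : Fin n → ℂ :=
  fun i => ⟨s * ((m i).1 + 1 / 2), s * ((m i).2 + 1 / 2)⟩

theorem mem_cell_iff {n : ℕ} {s : ℝ} (hs : 0 < s) {m : Fin n → ℤ × ℤ} {z : Fin n → ℂ} :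
    z ∈ cell s m ↔ ∀ i, (s * (m i).1 ≤ (z i).re ∧ (z i).re < s * ((m i).1 + 1)) ∧
      (s * (m i).2 ≤ (z i).im ∧ (z i).im < s * ((m i).2 + 1)) := by
  simp only [cell, cellIndex, Set.mem_preimage, Set.mem_singleton_iff, funext_iff, Prod.ext_iff,
    Int.floor_eq_iff, le_div_iff₀ hs, div_lt_iff₀ hs, mul_comm s]

theorem measurable_cellIndex {n : ℕ} (s : ℝ) : Measurable (cellIndex (n := n) s) := by
  refine measurable_pi_lambda _ fun i => Measurable.prodMk ?_ ?_
  · exact Int.measurable_floor.comp (by fun_prop)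
  · exact Int.measurable_floor.comp (by fun_prop)

theorem measurableSet_cell {n : ℕ} (s : ℝ) (m : Fin n → ℤ × ℤ) : MeasurableSet (cell s m) :=
  measurable_cellIndex s (measurableSet_singleton m)

theorem mem_cell_cellIndex {n : ℕ} (s : ℝ) (z : Fin n → ℂ) : z ∈ cell s (cellIndex s z) := rfl

theorem pairwise_disjoint_cell {n : ℕ} (s : ℝ) :
    Pairwise (Function.onFun Disjoint (cell (n := n) s)) := fun _ _ h =>
  Disjoint.preimage _ (by simpa using h)

theorem iUnion_cell {n : ℕ} (s : ℝ) : ⋃ m, cell (n := n) s m = Set.univ :=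
  Set.eq_univ_of_forall fun z => Set.mem_iUnion.2 ⟨_, mem_cell_cellIndex s z⟩

theorem lintegral_eq_tsum_cell {n : ℕ} (s : ℝ) (ν : Measure (Fin n → ℂ))
    (g : (Fin n → ℂ) → ℝ≥0∞) : ∫⁻ z, g z ∂ν = ∑' m, ∫⁻ z in cell s m, g z ∂ν := by
  rw [← lintegral_iUnion (measurableSet_cell s) (pairwise_disjoint_cell s), iUnion_cell,
    setLIntegral_univ]

theorem volume_cell_eq {n : ℕ} {s : ℝ} (hs : 0 < s) (m : Fin n → ℤ × ℤ) :
    volume (cell s m) = volume (cell s (0 : Fin n → ℤ × ℤ)) := by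
  have : cell s m = (fun u => u + -latticePoint s m) ⁻¹' cell s 0 := by
    ext z
    simp only [Set.mem_preimage, mem_cell_iff hs]
    refine forall_congr' fun i => ?_
    simp only [Pi.add_apply, Pi.neg_apply, Complex.add_re, Complex.add_im, Complex.neg_re,
      Complex.neg_im, latticePoint, Pi.zero_apply, Prod.fst_zero, Prod.snd_zero, Int.cast_zero]
    constructor <;> rintro ⟨⟨_, _⟩, _, _⟩ <;> refine ⟨⟨?_, ?_⟩, ?_, ?_⟩ <;> linarith
  rw [this, measure_preimage_add_right]

theorem cell_subset_cube_cellCenter {n : ℕ} {s : ℝ} (hs : 0 < s) (m : Fin n → ℤ × ℤ) :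
    cell s m ⊆ cube s (cellCenter s m) := fun z hz i => by
  obtain ⟨⟨h1, h2⟩, h3, h4⟩ := (mem_cell_iff hs).1 hz i
  simp only [cellCenter, Complex.sub_re, Complex.sub_im, abs_le]
  refine ⟨⟨?_, ?_⟩, ?_, ?_⟩ <;> linarith

theorem volume_cell_pos {n : ℕ} {s : ℝ} (hs : 0 < s) (m : Fin n → ℤ × ℤ) :
    0 < volume (cell s m) := by
  refine (Metric.measure_ball_pos volume (cellCenter s m) (half_pos hs)).trans_le
    (measure_mono fun z hz => (mem_cell_iff hs).2 fun i => ?_)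
  have h := (norm_le_pi_norm (z - cellCenter s m) i).trans_lt (mem_ball_iff_norm.1 hz)
  have h1 := abs_lt.1 ((Complex.abs_re_le_norm _).trans_lt h)
  have h2 := abs_lt.1 ((Complex.abs_im_le_norm _).trans_lt h)
  simp only [Pi.sub_apply, Complex.sub_re, Complex.sub_im, cellCenter] at h1 h2
  refine ⟨⟨?_, ?_⟩, ?_, ?_⟩ <;> linarith [h1.1, h1.2, h2.1, h2.2]

theorem volume_cell_ne_top {n : ℕ} {s : ℝ} (hs : 0 < s) (m : Fin n → ℤ × ℤ) :
    volume (cell s m) ≠ ∞ :=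
  ((measure_mono (cell_subset_cube_cellCenter hs m)).trans_lt
    (volume_cube_ne_top hs.le _).lt_top).ne

theorem cell_subset_cube_of_adjacent {n : ℕ} {s : ℝ} (hs : 0 < s) {c m : Fin n → ℤ × ℤ}
    (h : ∀ i, ((m i).1 ≤ (c i).1 ∧ (c i).1 ≤ (m i).1 + 1) ∧
      ((m i).2 ≤ (c i).2 ∧ (c i).2 ≤ (m i).2 + 1)) :
    cell s m ⊆ cube (2 * s) (latticePoint s c) := fun z hz i => by
  obtain ⟨⟨h1, h2⟩, h3, h4⟩ := (mem_cell_iff hs).1 hz i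
  obtain ⟨⟨a1, a2⟩, a3, a4⟩ := h i
  have a1' : ((m i).1 : ℝ) ≤ (c i).1 := by exact_mod_cast a1
  have a2' : ((c i).1 : ℝ) ≤ (m i).1 + 1 := by exact_mod_cast a2
  have a3' : ((m i).2 : ℝ) ≤ (c i).2 := by exact_mod_cast a3
  have a4' : ((c i).2 : ℝ) ≤ (m i).2 + 1 := by exact_mod_cast a4
  simp only [latticePoint, Complex.sub_re, Complex.sub_im, abs_le]
  refine ⟨⟨?_, ?_⟩, ?_, ?_⟩ <;> nlinarith

/-- Two adjacent cells lie in the cube of side `2 * s` about a common vertex, on which the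
comparison is applied to the indicator function of one of them. -/
theorem CubeComparable.exists_cell_le_of_adjacent {n : ℕ} {ν : Measure (Fin n → ℂ)} {s θ : ℝ}
    {C : ℝ≥0∞} (hν : CubeComparable ν (2 * s) θ C) (hC : C ≠ ∞) (hs : 0 < s) (hθ : 0 < θ) :
    ∃ D : ℝ≥0∞, D ≠ ∞ ∧ ∀ m m' : Fin n → ℤ × ℤ,
      (∀ i, |(m i).1 - (m' i).1| ≤ 1 ∧ |(m i).2 - (m' i).2| ≤ 1) →
        ν (cell s m) ≤ D * ν (cell s m') := by
  set v := volume (cell s (0 : Fin n → ℤ × ℤ))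
  have hv0 : v ≠ 0 := (volume_cell_pos hs _).ne'
  have hvtop : v ≠ ∞ := volume_cell_ne_top hs _
  refine ⟨(C / v) ^ (1 / θ), ENNReal.rpow_ne_top_of_nonneg (by positivity)
    (ENNReal.div_ne_top hC hv0), fun m m' h => ?_⟩
  -- the vertex whose index is the coordinatewise maximum is common to both closed cells
  set c : Fin n → ℤ × ℤ := fun i => (max (m i).1 (m' i).1, max (m i).2 (m' i).2) with hc
  set Q := cube (2 * s) (latticePoint s c)
  have hm : cell s m ⊆ Q := cell_subset_cube_of_adjacent hs fun i => by
    have := h i; simp only [hc, abs_le] at this ⊢; omega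
  have hm' : cell s m' ⊆ Q := cell_subset_cube_of_adjacent hs fun i => by
    have := h i; simp only [hc, abs_le] at this ⊢; omega
  have h1 := hν (latticePoint s c) ((cell s m').indicator 1)
    (measurable_one.indicator (measurableSet_cell s m'))
  have h2 : ∀ u, (cell s m').indicator (1 : (Fin n → ℂ) → ℝ≥0∞) u ^ θ
      = (cell s m').indicator 1 u := fun u => by
    by_cases hu : u ∈ cell s m' <;> simp [hu, hθ]
  simp only [h2] at h1
  rw [lintegral_indicator_one (measurableSet_cell s m'),
    lintegral_indicator_one (measurableSet_cell s m'),
    Measure.restrict_apply (measurableSet_cell s m'),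
    Measure.restrict_apply (measurableSet_cell s m'), Set.inter_eq_left.2 hm',
    volume_cell_eq hs] at h1
  refine (measure_mono hm).trans ?_
  rw [← ENNReal.rpow_le_rpow_iff hθ, ENNReal.mul_rpow_of_nonneg _ _ hθ.le, ← ENNReal.rpow_mul,
    one_div_mul_cancel hθ.ne', ENNReal.rpow_one, ENNReal.mul_comm_div, ← mul_div_assoc,
    ENNReal.le_div_iff_mul_le (Or.inl hv0) (Or.inl hvtop), mul_comm]
  exact h1

/-- The `ℓ¹` length of a lattice index. -/
def latticeLength {n : ℕ} (k : Fin n → ℤ × ℤ) : ℕ := ∑ i, ((k i).1.natAbs + (k i).2.natAbs)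

theorem CubeComparable.exists_cell_le_pow {n : ℕ} {ν : Measure (Fin n → ℂ)} {s θ : ℝ}
    {C : ℝ≥0∞} (hν : CubeComparable ν (2 * s) θ C) (hC : C ≠ ∞) (hs : 0 < s) (hθ : 0 < θ) :
    ∃ D : ℝ≥0∞, D ≠ ∞ ∧ ∀ m m' : Fin n → ℤ × ℤ,
        ν (cell s m) ≤ D ^ latticeLength (m - m') * ν (cell s m') := by
  obtain ⟨D, hD, h⟩ := hν.exists_cell_le_of_adjacent hC hs hθ
  refine ⟨D, hD, ?_⟩
  have key : ∀ d : ℕ, ∀ m m' : Fin n → ℤ × ℤ,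
      (∀ i, |(m i).1 - (m' i).1| ≤ d ∧ |(m i).2 - (m' i).2| ≤ d) →
        ν (cell s m) ≤ D ^ d * ν (cell s m') := by
    intro d
    induction d with
    | zero =>
      intro m m' hd
      have : m = m' := funext fun i => by
        have := hd i
        simp only [CharP.cast_eq_zero, abs_nonpos_iff, sub_eq_zero] at this
        exact Prod.ext this.1 this.2
      simp [this]
    | succ d ih =>
      intro m m' hd
      -- move every coordinate of `m` one step towards that of `m'`
      let m'' : Fin n → ℤ × ℤ := fun i =>
        ((m i).1 + ((m' i).1 - (m i).1).sign, (m i).2 + ((m' i).2 - (m i).2).sign)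
      have hstep : ∀ a b : ℤ, |a - b| ≤ ((d + 1 : ℕ) : ℤ) →
          |a - (a + (b - a).sign)| ≤ 1 ∧ |a + (b - a).sign - b| ≤ (d : ℤ) := by
        intro a b hab
        rw [abs_le] at hab
        rcases lt_trichotomy (b - a) 0 with h0 | h0 | h0
        · rw [Int.sign_eq_neg_one_of_neg h0, abs_le, abs_le]; omega
        · rw [h0, Int.sign_zero, abs_le, abs_le]; omega
        · rw [Int.sign_eq_one_of_pos h0, abs_le, abs_le]; omega
      calc ν (cell s m) ≤ D * ν (cell s m'') :=
            h m m'' fun i => ⟨(hstep _ _ (hd i).1).1, (hstep _ _ (hd i).2).1⟩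
        _ ≤ D * (D ^ d * ν (cell s m')) := by
            gcongr
            exact ih m'' m' fun i => ⟨(hstep _ _ (hd i).1).2, (hstep _ _ (hd i).2).2⟩
        _ = _ := by rw [pow_succ']; ring
  intro m m'
  refine key _ m m' fun i => ?_
  have h1 : (((m - m') i).1.natAbs + ((m - m') i).2.natAbs) ≤ latticeLength (m - m') :=
    Finset.single_le_sum (f := fun i => ((m - m') i).1.natAbs + ((m - m') i).2.natAbs)
      (fun _ _ => Nat.zero_le _) (Finset.mem_univ i)
  simp only [Pi.sub_apply, Prod.fst_sub, Prod.snd_sub] at h1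
  rw [abs_le, abs_le]
  omega

theorem ENNReal.tsum_pi_prod {ι : Type*} (g : ι → ℝ≥0∞) (n : ℕ) :
    ∑' k : Fin n → ι, ∏ i, g (k i) = (∑' x, g x) ^ n := by
  induction n with
  | zero => simp
  | succ n ih =>
    rw [← (Fin.consEquiv fun _ : Fin (n + 1) => ι).tsum_eq, ENNReal.tsum_prod', pow_succ', ← ih,
      ← ENNReal.tsum_mul_right]
    refine tsum_congr fun x => ?_
    rw [← ENNReal.tsum_mul_left]
    refine tsum_congr fun k => ?_
    simp [Fin.prod_univ_succ, Fin.consEquiv]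

theorem tsum_pow_natAbs_mul_exp_neg_sq_ne_top {D : ℝ≥0∞} (hD : D ≠ ∞) {c : ℝ} (hc : 0 < c) :
    ∑' a : ℤ, D ^ a.natAbs * ENNReal.ofReal (Real.exp (-c * (a : ℝ) ^ 2)) ≠ ∞ := by
  set b := D.toReal with hb
  have hb0 : 0 ≤ b := ENNReal.toReal_nonneg
  have hDb : D ≤ ENNReal.ofReal (Real.exp b) := by
    rw [← ENNReal.ofReal_toReal hD]
    exact ENNReal.ofReal_le_ofReal (by linarith [Real.add_one_le_exp b])
  have hsum : Summable fun a : ℤ =>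
      Real.exp ((b + 1) ^ 2 / (4 * c)) * Real.exp (-(a.natAbs : ℝ)) := by
    refine Summable.mul_left _ (Summable.of_nat_of_neg ?_ ?_)
    · simpa using Real.summable_exp_neg_nat
    · simpa using Real.summable_exp_neg_nat
  refine ne_top_of_le_ne_top hsum.tsum_ofReal_ne_top (ENNReal.tsum_le_tsum fun a => ?_)
  calc _ ≤ ENNReal.ofReal (Real.exp b) ^ a.natAbs *
          ENNReal.ofReal (Real.exp (-c * (a : ℝ) ^ 2)) := by
        gcongr
    _ ≤ _ := by
        rw [← ENNReal.ofReal_pow (Real.exp_nonneg _), ← ENNReal.ofReal_mul (by positivity),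
          ← Real.exp_nat_mul, ← Real.exp_add, ← Real.exp_add]
        refine ENNReal.ofReal_le_ofReal (Real.exp_le_exp.2 ?_)
        have h1 : (a : ℝ) ^ 2 = (a.natAbs : ℝ) ^ 2 := by
          rw [Nat.cast_natAbs, Int.cast_abs, sq_abs]
        rw [h1]
        set x := (a.natAbs : ℝ)
        -- the right-hand side is the maximum of the left-hand side over all real `x`
        have h2 : (b + 1) * x - c * x ^ 2 ≤ (b + 1) ^ 2 / (4 * c) := by
          rw [le_div_iff₀ (by positivity)]
          nlinarith [sq_nonneg (2 * c * x - (b + 1))]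
        linarith

/-- A Gaussian centred at a lattice point is bounded by a function of the difference of the cell
indices, and that function is summable even against an exponentially growing factor. -/
theorem exists_gaussian_majorant {s c : ℝ} (hs : 0 < s) (hc : 0 < c) (n : ℕ) {D : ℝ≥0∞}
    (hD : D ≠ ∞) :
    ∃ Γ : (Fin n → ℤ × ℤ) → ℝ≥0∞,
      (∀ z m, ENNReal.ofReal (Real.exp (-c * normSqC (z - latticePoint s m)))
        ≤ Γ (cellIndex s z - m)) ∧
      ∑' k, D ^ latticeLength k * Γ k ≠ ∞ := by
  set c' := c * s ^ 2 / 2 with hc'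
  have hc'pos : 0 < c' := by positivity
  let γ : ℤ → ℝ≥0∞ := fun a => ENNReal.ofReal (Real.exp (-c' * (a : ℝ) ^ 2))
  refine ⟨fun k => ENNReal.ofReal (Real.exp (n * (4 * c'))) * ∏ i, (γ (k i).1 * γ (k i).2),
    fun z m => ?_, ?_⟩
  · simp only [γ]
    rw [Finset.prod_congr rfl fun i _ => (ENNReal.ofReal_mul (Real.exp_nonneg _)).symm,
      ← ENNReal.ofReal_prod_of_nonneg (fun i _ => by positivity),
      ← ENNReal.ofReal_mul (Real.exp_nonneg _)]
    refine ENNReal.ofReal_le_ofReal ?_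
    simp only [← Real.exp_add]
    rw [← Real.exp_sum, ← Real.exp_add, Real.exp_le_exp, normSqC, Finset.mul_sum,
      show (n : ℝ) * (4 * c') = ∑ _i : Fin n, 4 * c' by simp, ← Finset.sum_add_distrib]
    refine Finset.sum_le_sum fun i _ => ?_
    obtain ⟨⟨h1, h2⟩, h3, h4⟩ := (mem_cell_iff hs).1 (mem_cell_cellIndex s z) i
    set k := cellIndex s z
    have aux : ∀ x a b : ℝ, s * a ≤ x → x < s * (a + 1) →
        s ^ 2 * (a - b) ^ 2 / 2 - s ^ 2 ≤ (x - s * b) ^ 2 := by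
      intro x a b hx1 hx2
      have e1 : (x - s * a) ^ 2 ≤ s ^ 2 := by
        apply sq_le_sq' <;> nlinarith
      nlinarith [sq_nonneg (s * (a - b) + 2 * (x - s * a))]
    have f1 := aux _ _ (m i).1 h1 h2
    have f2 := aux _ _ (m i).2 h3 h4
    rw [← Complex.normSq_eq_norm_sq, Complex.normSq_apply]
    simp only [Pi.sub_apply, Complex.sub_re, Complex.sub_im, latticePoint, Prod.fst_sub,
      Prod.snd_sub, Int.cast_sub, hc']
    nlinarith
  · have e : ∀ k : Fin n → ℤ × ℤ, D ^ latticeLength k * (ENNReal.ofReal (Real.exp (n * (4 * c'))) *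
        ∏ i, (γ (k i).1 * γ (k i).2)) = ENNReal.ofReal (Real.exp (n * (4 * c'))) *
          ∏ i, ((D ^ (k i).1.natAbs * γ (k i).1) * (D ^ (k i).2.natAbs * γ (k i).2)) := by
      intro k
      rw [mul_left_comm, latticeLength, ← Finset.prod_pow_eq_pow_sum, ← Finset.prod_mul_distrib]
      congr 1
      refine Finset.prod_congr rfl fun i _ => ?_
      rw [pow_add]; ring
    simp only [e]
    rw [ENNReal.tsum_mul_left, ENNReal.tsum_pi_prod
      (fun x : ℤ × ℤ => (D ^ x.1.natAbs * γ x.1) * (D ^ x.2.natAbs * γ x.2)), ENNReal.tsum_prod']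
    simp only [ENNReal.tsum_mul_left, ENNReal.tsum_mul_right]
    have := tsum_pow_natAbs_mul_exp_neg_sq_ne_top hD hc'pos
    exact ENNReal.mul_ne_top ENNReal.ofReal_ne_top
      (ENNReal.pow_ne_top (ENNReal.mul_ne_top this this))

/-! ### Gaussian sums and suprema over cells -/

theorem exists_tsum_gaussian_le {s c : ℝ} (hs : 0 < s) (hc : 0 < c) (n : ℕ) :
    ∃ A : ℝ≥0∞, A ≠ ∞ ∧ ∀ z : Fin n → ℂ,
      ∑' m, ENNReal.ofReal (Real.exp (-c * normSqC (z - latticePoint s m))) ≤ A := by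
  obtain ⟨Γ, hΓ, hsum⟩ := exists_gaussian_majorant hs hc n ENNReal.one_ne_top
  simp only [one_pow, one_mul] at hsum
  refine ⟨_, hsum, fun z => ?_⟩
  exact (ENNReal.tsum_le_tsum fun m => hΓ z m).trans_eq
    ((Equiv.subLeft (cellIndex s z)).tsum_eq Γ)

/-- A Gaussian centred at a lattice point has mass comparable to that of the cell at this point,
because the masses of the other cells grow at most exponentially. -/
theorem CubeComparable.exists_lintegral_gaussian_le {n : ℕ} {ν : Measure (Fin n → ℂ)} {s θ c : ℝ}
    {C : ℝ≥0∞} (hν : CubeComparable ν (2 * s) θ C) (hC : C ≠ ∞) (hs : 0 < s) (hθ : 0 < θ)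
    (hc : 0 < c) :
    ∃ A : ℝ≥0∞, A ≠ ∞ ∧ ∀ m : Fin n → ℤ × ℤ,
      ∫⁻ z, ENNReal.ofReal (Real.exp (-c * normSqC (z - latticePoint s m))) ∂ν
        ≤ A * ν (cell s m) := by
  obtain ⟨D, hD, hle⟩ := hν.exists_cell_le_pow hC hs hθ
  obtain ⟨Γ, hΓ, hsum⟩ := exists_gaussian_majorant hs hc n hD
  refine ⟨_, hsum, fun m => ?_⟩
  rw [lintegral_eq_tsum_cell s, ← (Equiv.addRight m).tsum_eq, ← ENNReal.tsum_mul_right]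
  refine ENNReal.tsum_le_tsum fun k => ?_
  rw [Equiv.coe_addRight]
  calc _ ≤ ∫⁻ z in cell s (k + m), Γ k ∂ν := by
        refine setLIntegral_mono' (measurableSet_cell s _) fun z hz => ?_
        have : cellIndex s z = k + m := hz
        simpa [this] using hΓ z m
    _ = Γ k * ν (cell s (k + m)) := setLIntegral_const _ _
    _ ≤ Γ k * (D ^ latticeLength (k + m - m) * ν (cell s m)) := by gcongr; exact hle _ _
    _ = _ := by rw [add_sub_cancel_right]; ring

/-- The doubled cells have bounded overlap. -/
theorem exists_tsum_setLIntegral_cube_le (n : ℕ) :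
    ∃ N : ℝ≥0∞, N ≠ ∞ ∧ ∀ s : ℝ, 0 < s → ∀ (ν : Measure (Fin n → ℂ)) (g : (Fin n → ℂ) → ℝ≥0∞),
      ∑' m, ∫⁻ z in cube (2 * s) (cellCenter s m), g z ∂ν ≤ N * ∫⁻ z, g z ∂ν := by
  set K : Finset (Fin n → ℤ × ℤ) :=
    Fintype.piFinset fun _ => Finset.Icc (-1) 1 ×ˢ Finset.Icc (-1) 1
  refine ⟨K.card, ENNReal.natCast_ne_top _, fun s hs ν g => ?_⟩
  have hsub : ∀ m, cube (2 * s) (cellCenter s m) ⊆ ⋃ k : K, cell s (k.1 + m) := by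
    intro m z hz
    refine Set.mem_iUnion.2 ⟨⟨cellIndex s z - m, ?_⟩, by simp [cell]⟩
    rw [Fintype.mem_piFinset]
    intro i
    have h := hz i
    have aux : ∀ (x : ℝ) (a : ℤ), |x - s * (a + 1 / 2)| ≤ 2 * s / 2 →
        -1 ≤ ⌊x / s⌋ - a ∧ ⌊x / s⌋ - a ≤ 1 := by
      intro x a hx
      rw [abs_le] at hx
      have h1 : (a : ℝ) - 1 ≤ x / s := by rw [le_div_iff₀ hs]; nlinarith
      have h2 : x / s < a + 2 := by rw [div_lt_iff₀ hs]; nlinarith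
      have h3 : a - 1 ≤ ⌊x / s⌋ := Int.le_floor.2 (by push_cast; exact h1)
      have h4 : ⌊x / s⌋ < a + 2 := Int.floor_lt.2 (by push_cast; exact h2)
      omega
    simp only [cellCenter, Complex.sub_re, Complex.sub_im] at h
    simp only [Finset.mem_product, Finset.mem_Icc]
    exact ⟨aux _ _ h.1, aux _ _ h.2⟩
  calc ∑' m, ∫⁻ z in cube (2 * s) (cellCenter s m), g z ∂ν
      ≤ ∑' m, ∑ k : K, ∫⁻ z in cell s (k.1 + m), g z ∂ν := by
        refine ENNReal.tsum_le_tsum fun m => ?_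
        refine (lintegral_mono_set (hsub m)).trans ((lintegral_iUnion_le _ _).trans ?_)
        rw [tsum_fintype]
    _ = ∑ k : K, ∑' m, ∫⁻ z in cell s (k.1 + m), g z ∂ν :=
        Summable.tsum_finsetSum fun _ _ => ENNReal.summable
    _ = ∑ k : K, ∫⁻ z, g z ∂ν := by
        refine Finset.sum_congr rfl fun k _ => ?_
        rw [lintegral_eq_tsum_cell s ν g]
        exact (Equiv.addLeft k.1).tsum_eq fun m => ∫⁻ z in cell s m, g z ∂ν
    _ = _ := by simp

theorem closedBall_subset_cube_cellCenter {n : ℕ} {s : ℝ} (hs : 0 < s) {m : Fin n → ℤ × ℤ}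
    {a : Fin n → ℂ} (ha : a ∈ cell s m) :
    Metric.closedBall a (s / 2) ⊆ cube (2 * s) (cellCenter s m) := fun z hz i => by
  have h1 := closedBall_subset_cube s a hz i
  have h2 := cell_subset_cube_cellCenter hs m ha i
  simp only [Complex.sub_re, Complex.sub_im, abs_le] at h1 h2 ⊢
  refine ⟨⟨?_, ?_⟩, ?_, ?_⟩ <;>
    linarith [h1.1.1, h1.1.2, h1.2.1, h1.2.2, h2.1.1, h2.1.2, h2.2.1, h2.2.2]

/-- The discretized `L^p` quasi-norm, with suprema over the cells, is bounded by the `L^p`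
quasi-norm for entire functions. The sub-mean value property is used with exponent `p * θ`. -/
theorem CubeComparable.exists_tsum_iSup_fockModulus_le {n : ℕ} {ν : Measure (Fin n → ℂ)}
    {s θ α p : ℝ} {C : ℝ≥0∞} (hν : CubeComparable ν (2 * s) θ C) (hC : C ≠ ∞) (hs : 0 < s)
    (hθ : 0 < θ) (hα : 0 < α) (hp : 0 < p) :
    ∃ A : ℝ≥0∞, A ≠ ∞ ∧ ∀ f : (Fin n → ℂ) → ℂ, Differentiable ℂ f →
      ∑' m, (⨆ z ∈ cell s m, fockModulus α f z ^ p) * ν (cell s m)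
        ≤ A * ∫⁻ z, fockModulus α f z ^ p ∂ν := by
  obtain ⟨C₁, hC₁, h₁⟩ := exists_fockModulus_rpow_le (mul_pos hp hθ) (half_pos hs) hα n
  obtain ⟨N, hN, hcover⟩ := exists_tsum_setLIntegral_cube_le n
  set B := (C₁ * C) ^ (1 / θ) with hB
  have hBtop : B ≠ ∞ := ENNReal.rpow_ne_top_of_nonneg (by positivity) (ENNReal.mul_ne_top hC₁ hC)
  refine ⟨B * N, ENNReal.mul_ne_top hBtop hN, fun f hf => ?_⟩
  have hm : Measurable fun z => fockModulus α f z ^ p :=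
    (continuous_fockModulus α hf.continuous).measurable.pow_const p
  have key : ∀ m, (⨆ z ∈ cell s m, fockModulus α f z ^ p) * ν (cell s m) ≤
      B * ∫⁻ z in cube (2 * s) (cellCenter s m), fockModulus α f z ^ p ∂ν := by
    intro m
    simp only [ENNReal.iSup_mul]
    refine iSup₂_le fun a ha => ?_
    set Q := cube (2 * s) (cellCenter s m)
    have hcell : ν (cell s m) ≤ ν Q := measure_mono fun z hz =>
      closedBall_subset_cube_cellCenter hs hz (Metric.mem_closedBall_self (half_pos hs).le)
    rw [← ENNReal.rpow_le_rpow_iff hθ, ENNReal.mul_rpow_of_nonneg _ _ hθ.le,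
      ENNReal.mul_rpow_of_nonneg _ _ hθ.le, hB, ← ENNReal.rpow_mul, ← ENNReal.rpow_mul,
      one_div_mul_cancel hθ.ne', ENNReal.rpow_one]
    calc fockModulus α f a ^ (p * θ) * ν (cell s m) ^ θ
        ≤ (C₁ * ∫⁻ z in Q, (fockModulus α f z ^ p) ^ θ) * ν Q ^ θ := by
          gcongr
          refine (h₁ f hf a).trans ?_
          simp only [← ENNReal.rpow_mul]
          gcongr
          exact closedBall_subset_cube_cellCenter hs ha
      _ = C₁ * ((∫⁻ z in Q, (fockModulus α f z ^ p) ^ θ) * ν Q ^ θ) := mul_assoc _ _ _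
      _ ≤ C₁ * (C * (∫⁻ z in Q, fockModulus α f z ^ p ∂ν) ^ θ) := by
          gcongr 1
          exact hν _ _ hm
      _ = _ := (mul_assoc _ _ _).symm
  calc _ ≤ ∑' m, B * ∫⁻ z in cube (2 * s) (cellCenter s m), fockModulus α f z ^ p ∂ν :=
        ENNReal.tsum_le_tsum key
    _ ≤ _ := by
        rw [ENNReal.tsum_mul_left, mul_assoc]
        gcongr
        exact hcover s hs ν _

/-! ### The discrete inequality implies the embedding -/

theorem lintegral_ofReal_eq_lintegral_fockModulus {n : ℕ} {p : ℝ} (hp : 0 < p) (α : ℝ)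
    {w : (Fin n → ℂ) → ℝ} (hw : IsWeight w) {f : (Fin n → ℂ) → ℂ} (hf : Continuous f) :
    ∫⁻ z, ENNReal.ofReal (‖f z‖ ^ p * Real.exp (-(p * α / 2) * normSqC z) * w z)
      = ∫⁻ z, fockModulus α f z ^ p ∂weightMeasure w := by
  rw [lintegral_weightMeasure hw ((continuous_fockModulus α hf).measurable.pow_const p)]
  refine lintegral_congr fun z => ?_
  rw [fockModulus_rpow hp.le, mul_comm, ENNReal.ofReal_mul (hw.nonneg z)]

theorem weightedNorm_rpow {n : ℕ} {p : ℝ} (hp : 0 < p) (α : ℝ)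
    {w : (Fin n → ℂ) → ℝ} (hw : IsWeight w) {f : (Fin n → ℂ) → ℂ} (hf : Continuous f) :
    weightedNorm p α w f ^ p = ∫⁻ z, fockModulus α f z ^ p ∂weightMeasure w := by
  rw [weightedNorm, ← ENNReal.rpow_mul, one_div_mul_cancel hp.ne', ENNReal.rpow_one,
    lintegral_ofReal_eq_lintegral_fockModulus hp α hw hf]

theorem measureNorm_eq {n : ℕ} {q : ℝ} (hq : 0 < q) (α : ℝ)
    (μ : Measure (Fin n → ℂ)) (f : (Fin n → ℂ) → ℂ) :
    measureNorm q α μ f = (∫⁻ z, fockModulus α f z ^ q ∂μ) ^ (1 / q) := by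
  simp only [measureNorm, fockModulus_rpow hq.le]

theorem ofReal_prod_eq_prod_fockModulus {n k : ℕ} {q : Fin k → ℝ} (hq : ∀ j, 0 < q j)
    (α : Fin k → ℝ) (f : Fin k → (Fin n → ℂ) → ℂ) (z : Fin n → ℂ) :
    ENNReal.ofReal (∏ j, ‖f j z‖ ^ q j * Real.exp (-(q j * α j / 2) * normSqC z))
      = ∏ j, fockModulus (α j) (f j) z ^ q j := by
  rw [ENNReal.ofReal_prod_of_nonneg fun j _ => by positivity]
  exact Finset.prod_congr rfl fun j _ => (fockModulus_rpow (hq j).le _ _ _).symm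

/-- Carleson measures are the case of a single factor in the multilinear inequality. -/
theorem isCarleson_iff_productEmbedding {n : ℕ} {q p α : ℝ} (hq : 0 < q) (w : (Fin n → ℂ) → ℝ)
    (μ : Measure (Fin n → ℂ)) :
    IsCarleson q p α w μ ↔
      ProductEmbedding w μ (fun _ : Fin 1 => p) (fun _ => q) (fun _ => α) := by
  constructor
  · rintro ⟨C, hC, h⟩
    refine ⟨C ^ q, by positivity, fun f hf => ?_⟩
    have h1 := ENNReal.rpow_le_rpow (h (f 0) (hf 0)) hq.le
    rw [measureNorm_eq hq, ← ENNReal.rpow_mul, one_div_mul_cancel hq.ne', ENNReal.rpow_one,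
      ENNReal.mul_rpow_of_nonneg _ _ hq.le, ENNReal.ofReal_rpow_of_nonneg hC.le hq.le] at h1
    simp only [ofReal_prod_eq_prod_fockModulus fun _ : Fin 1 => hq]
    simpa using h1
  · rintro ⟨C, hC, h⟩
    refine ⟨C ^ (1 / q), by positivity, fun f hf => ?_⟩
    have h1 := h (fun _ => f) fun _ => hf
    simp only [Finset.univ_unique, Finset.prod_singleton] at h1
    have h2 := ENNReal.rpow_le_rpow h1 (one_div_pos.2 hq).le
    rw [measureNorm]
    rwa [ENNReal.mul_rpow_of_nonneg _ _ (one_div_pos.2 hq).le, ← ENNReal.rpow_mul,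
      mul_one_div_cancel hq.ne', ENNReal.rpow_one,
      ENNReal.ofReal_rpow_of_nonneg hC.le (one_div_pos.2 hq).le] at h2

/-- The discrete inequality to which all the embeddings reduce: `∑ e_m ^ lam * μ(P_m)` is bounded by
a constant times `(∑ e_m * ν(P_m)) ^ lam`. For `lam ≥ 1` it says that `μ(P_m) ≤ C * ν(P_m) ^ lam`,
but no distinction between `lam ≥ 1` and `lam < 1` is needed. -/
def CellEmbedding {n : ℕ} (s lam : ℝ) (ν μ : Measure (Fin n → ℂ)) : Prop :=
  ∃ C : ℝ≥0∞, C ≠ ∞ ∧ ∀ (S : Finset (Fin n → ℤ × ℤ)) (e : (Fin n → ℤ × ℤ) → NNReal),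
    ∑ m ∈ S, (e m : ℝ≥0∞) ^ lam * μ (cell s m) ≤ C * (∑ m ∈ S, e m * ν (cell s m)) ^ lam

theorem iSup_fockModulus_ne_top {n : ℕ} {s : ℝ} (hs : 0 < s) {p : ℝ} (hp : 0 ≤ p) (α : ℝ)
    {f : (Fin n → ℂ) → ℂ} (hf : Continuous f) (m : Fin n → ℤ × ℤ) :
    (⨆ z ∈ cell s m, fockModulus α f z ^ p) ≠ ∞ := by
  obtain ⟨M, hM⟩ := (isCompact_cube hs.le (cellCenter s m)).bddAbove_image
    (f := fun z => ‖f z‖ * Real.exp (-(α / 2) * normSqC z)) (by fun_prop)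
  refine ne_top_of_le_ne_top (ENNReal.rpow_ne_top_of_nonneg hp (ENNReal.ofReal_ne_top (r := M)))
    (iSup₂_le fun z hz => ?_)
  unfold fockModulus
  gcongr
  exact hM (Set.mem_image_of_mem _ (cell_subset_cube_cellCenter hs m hz))

/-- Hölder's inequality for several sequences on the lattice. It is the integral form for the image
of `ν` under `cellIndex`. -/
theorem tsum_prod_rpow_mul_cell_le {n k : ℕ} (s : ℝ) (ν : Measure (Fin n → ℂ))
    (E : Fin k → (Fin n → ℤ × ℤ) → ℝ≥0∞) {θ : Fin k → ℝ} (hθ : ∀ j, 0 ≤ θ j)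
    (hsum : ∑ j, θ j = 1) :
    ∑' m, (∏ j, E j m ^ θ j) * ν (cell s m) ≤ ∏ j, (∑' m, E j m * ν (cell s m)) ^ θ j := by
  have h := ENNReal.lintegral_prod_norm_pow_le (μ := ν.map (cellIndex s)) Finset.univ
    (f := E) (fun j _ => (measurable_of_countable _).aemeasurable) hsum fun j _ => hθ j
  simp only [lintegral_countable', Measure.map_apply (measurable_cellIndex s)
    (measurableSet_singleton _)] at h
  exact h

theorem CellEmbedding.productEmbedding {n k : ℕ} (hk : 1 ≤ k) {w : (Fin n → ℂ) → ℝ}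
    (hw : IsWeight w) {s θ : ℝ} {C : ℝ≥0∞} (hν : CubeComparable (weightMeasure w) (2 * s) θ C)
    (hC : C ≠ ∞) (hs : 0 < s) (hθ : 0 < θ) {μ : Measure (Fin n → ℂ)} {p q α : Fin k → ℝ}
    (hp : ∀ j, 0 < p j) (hq : ∀ j, 0 < q j) (hα : ∀ j, 0 < α j)
    (h : CellEmbedding s (∑ j, q j / p j) (weightMeasure w) μ) :
    ProductEmbedding w μ p q α := by
  obtain ⟨B, hB, h⟩ := h
  choose A hA hAle using fun j =>
    hν.exists_tsum_iSup_fockModulus_le hC hs hθ (hα j) (hp j)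
  set lam := ∑ j, q j / p j with hlam
  have hqp : ∀ j, 0 < q j / p j := fun j => div_pos (hq j) (hp j)
  have hlampos : 0 < lam := Finset.sum_pos (fun j _ => hqp j) ⟨⟨0, hk⟩, Finset.mem_univ _⟩
  set K := B * ∏ j, A j ^ (q j / p j) with hK
  have hKtop : K ≠ ∞ := ENNReal.mul_ne_top hB (ENNReal.prod_ne_top fun j _ =>
    ENNReal.rpow_ne_top_of_nonneg (hqp j).le (hA j))
  refine ⟨K.toReal + 1, by positivity, fun f hf => ?_⟩
  have hKle : K ≤ ENNReal.ofReal (K.toReal + 1) := by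
    rw [← ENNReal.ofReal_toReal hKtop, ENNReal.toReal_ofReal ENNReal.toReal_nonneg]
    exact ENNReal.ofReal_le_ofReal (by linarith)
  refine le_trans ?_ (mul_le_mul' hKle le_rfl)
  simp only [ofReal_prod_eq_prod_fockModulus hq]
  set ν := weightMeasure w
  let E : Fin k → (Fin n → ℤ × ℤ) → ℝ≥0∞ := fun j m =>
    ⨆ z ∈ cell s m, fockModulus (α j) (f j) z ^ p j
  -- the weighted geometric mean of the `E j m`; its power `lam` is `∏ E j m ^ (q j / p j)`
  let e : (Fin n → ℤ × ℤ) → ℝ≥0∞ := fun m => ∏ j, E j m ^ (q j / p j / lam)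
  have hlamj : ∀ j, 0 ≤ q j / p j / lam := fun j => (div_pos (hqp j) hlampos).le
  have hE : ∀ j m, E j m ≠ ∞ := fun j m =>
    iSup_fockModulus_ne_top hs (hp j).le (α j) (hf j).1.continuous m
  have he : ∀ m, e m ≠ ∞ := fun m => ENNReal.prod_ne_top fun j _ =>
    ENNReal.rpow_ne_top_of_nonneg (hlamj j) (hE j m)
  have hprod : ∀ x : Fin k → ℝ≥0∞, (∏ j, x j ^ (q j / p j / lam)) ^ lam
      = ∏ j, x j ^ (q j / p j) := fun x => by
    rw [← ENNReal.prod_rpow_of_nonneg hlampos.le]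
    refine Finset.prod_congr rfl fun j _ => ?_
    rw [← ENNReal.rpow_mul, div_mul_cancel₀ _ hlampos.ne']
  calc ∫⁻ z, ∏ j, fockModulus (α j) (f j) z ^ q j ∂μ
      = ∑' m, ∫⁻ z in cell s m, ∏ j, fockModulus (α j) (f j) z ^ q j ∂μ :=
        lintegral_eq_tsum_cell s _ _
    _ ≤ ∑' m, e m ^ lam * μ (cell s m) := by
        refine ENNReal.tsum_le_tsum fun m => ?_
        rw [← setLIntegral_const]
        refine setLIntegral_mono' (measurableSet_cell s m) fun z hz => ?_
        rw [hprod]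
        refine Finset.prod_le_prod' fun j _ => ?_
        calc fockModulus (α j) (f j) z ^ q j
            = (fockModulus (α j) (f j) z ^ p j) ^ (q j / p j) := by
              rw [← ENNReal.rpow_mul, mul_div_cancel₀ _ (hp j).ne']
          _ ≤ E j m ^ (q j / p j) := by
              refine ENNReal.rpow_le_rpow ?_ (hqp j).le
              exact le_iSup₂ (f := fun z _ => fockModulus (α j) (f j) z ^ p j) z hz
    _ ≤ B * (∑' m, e m * ν (cell s m)) ^ lam := by
        rw [ENNReal.tsum_eq_iSup_sum]
        refine iSup_le fun S => ?_
        have := h S fun m => (e m).toNNReal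
        simp only [ENNReal.coe_toNNReal (he _)] at this
        refine this.trans ?_
        gcongr
        exact ENNReal.sum_le_tsum S
    _ ≤ B * (∏ j, (∑' m, E j m * ν (cell s m)) ^ (q j / p j / lam)) ^ lam := by
        gcongr
        refine tsum_prod_rpow_mul_cell_le s ν E hlamj ?_
        rw [← Finset.sum_div, div_self hlampos.ne']
    _ = B * ∏ j, (∑' m, E j m * ν (cell s m)) ^ (q j / p j) := by rw [hprod]
    _ ≤ B * ∏ j, (A j * weightedNorm (p j) (α j) w (f j) ^ p j) ^ (q j / p j) := by
        gcongr with j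
        · exact (hqp j).le
        · rw [weightedNorm_rpow (hp j) _ hw (hf j).1.continuous]
          exact hAle j (f j) (hf j).1
    _ = K * ∏ j, weightedNorm (p j) (α j) w (f j) ^ q j := by
        rw [hK, mul_assoc, ← Finset.prod_mul_distrib]
        congr 1
        refine Finset.prod_congr rfl fun j _ => ?_
        rw [ENNReal.mul_rpow_of_nonneg _ _ (hqp j).le, ← ENNReal.rpow_mul,
          mul_div_cancel₀ _ (hp j).ne']

/-! ### The embedding implies the discrete inequality -/

theorem ENNReal.rpow_finset_sum_of_nonneg {ι : Type*} (S : Finset ι) {a : ι → ℝ}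
    (ha : ∀ i, 0 ≤ a i) (x : ℝ≥0∞) : x ^ (∑ i ∈ S, a i) = ∏ i ∈ S, x ^ a i := by
  classical
  induction S using Finset.induction with
  | empty => simp
  | insert i S hi ih =>
    rw [Finset.sum_insert hi, Finset.prod_insert hi,
      ENNReal.rpow_add_of_nonneg _ _ (ha i) (Finset.sum_nonneg fun i _ => ha i), ih]

theorem ENNReal.sum_rpow_le_sum_rpow {ι : Type*} (S : Finset ι) (x : ι → ℝ≥0∞) {p : ℝ}
    (hp : 0 < p) (hp1 : p ≤ 1) : (∑ i ∈ S, x i) ^ p ≤ ∑ i ∈ S, x i ^ p := by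
  classical
  induction S using Finset.induction with
  | empty => simp [hp]
  | insert i S hi ih =>
    rw [Finset.sum_insert hi, Finset.sum_insert hi]
    exact (ENNReal.rpow_add_le_add_rpow _ _ hp.le hp1).trans (by gcongr)

/-- On average over the signs, `|∑ ± A i| ^ q` is at least `|A i₀| ^ q / 2`: of two sign patterns
that differ only at `i₀`, one gives a sum of modulus at least `|A i₀|`. -/
theorem card_mul_enorm_rpow_le_sum_signs {ι : Type*} [Fintype ι] [DecidableEq ι] (A : ι → ℂ)
    (i₀ : ι) {q : ℝ} (hq : 0 < q) :
    (Fintype.card (ι → ℤˣ) : ℝ≥0∞) * ‖A i₀‖ₑ ^ q ≤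
      2 * ∑ ε : ι → ℤˣ, ‖∑ i, ((ε i : ℤ) : ℂ) * A i‖ₑ ^ q := by
  set X : (ι → ℤˣ) → ℂ := fun ε => ∑ i, ((ε i : ℤ) : ℂ) * A i with hX
  set δ : ι → ℤˣ := Function.update 1 i₀ (-1) with hδ
  have hflip : ∑ ε, ‖X (ε * δ)‖ₑ ^ q = ∑ ε, ‖X ε‖ₑ ^ q :=
    Equiv.sum_comp (Equiv.mulRight δ) fun ε => ‖X ε‖ₑ ^ q
  have hdiff : ∀ ε, X ε - X (ε * δ) = 2 * (((ε i₀ : ℤ) : ℂ) * A i₀) := by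
    intro ε
    rw [hX]
    simp only [← Finset.sum_sub_distrib]
    rw [Finset.sum_eq_single i₀]
    · simp [hδ]; ring
    · intro i _ hi; simp [hδ, hi]
    · simp
  have hsign : ∀ u : ℤˣ, ‖((u : ℤ) : ℂ)‖ = 1 := fun u => by
    rcases Int.units_eq_one_or u with rfl | rfl <;> simp
  have hpt : ∀ ε, ‖A i₀‖ₑ ^ q ≤ ‖X ε‖ₑ ^ q + ‖X (ε * δ)‖ₑ ^ q := by
    intro ε
    have h1 : 2 * ‖A i₀‖ ≤ ‖X ε‖ + ‖X (ε * δ)‖ := by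
      have := norm_sub_le (X ε) (X (ε * δ))
      rw [hdiff, norm_mul, norm_mul, hsign, one_mul] at this
      simpa using this
    rcases le_total ‖X ε‖ ‖X (ε * δ)‖ with h | h
    · refine le_trans ?_ le_add_self
      gcongr
      rw [enorm_le_iff_norm_le]; linarith
    · refine le_trans ?_ le_self_add
      gcongr
      rw [enorm_le_iff_norm_le]; linarith
  calc (Fintype.card (ι → ℤˣ) : ℝ≥0∞) * ‖A i₀‖ₑ ^ q = ∑ _ε : ι → ℤˣ, ‖A i₀‖ₑ ^ q := by
        rw [Finset.sum_const, Finset.card_univ, nsmul_eq_mul]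
    _ ≤ ∑ ε, (‖X ε‖ₑ ^ q + ‖X (ε * δ)‖ₑ ^ q) := Finset.sum_le_sum fun ε _ => hpt ε
    _ = _ := by rw [Finset.sum_add_distrib, hflip, two_mul]

/-- The normalized reproducing kernel `e^{α⟨z,u⟩ - α|u|²/2}` of the Fock space at `u`. -/
def fockKernel {n : ℕ} (α : ℝ) (u z : Fin n → ℂ) : ℂ :=
  Complex.exp (α * (∑ i, z i * star (u i) - normSqC u / 2))

theorem differentiable_fockKernel {n : ℕ} (α : ℝ) (u : Fin n → ℂ) :
    Differentiable ℂ (fockKernel α u) := by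
  unfold fockKernel; fun_prop

theorem fockModulus_fockKernel {n : ℕ} (α : ℝ) (u z : Fin n → ℂ) :
    fockModulus α (fockKernel α u) z
      = ENNReal.ofReal (Real.exp (-(α / 2) * normSqC (z - u))) := by
  have h := norm_mul_exp_eq α (fockKernel α u) u z
  rw [fockKernel, ← Complex.exp_add, ← mul_add, sub_add_sub_cancel, sub_self, mul_zero,
    Complex.exp_zero, norm_one] at h
  rw [fockModulus]
  congr 1
  rw [neg_mul (α / 2) (normSqC (z - u)), Real.exp_neg]
  exact eq_inv_of_mul_eq_one_left h.symm

theorem fockModulus_eq_enorm_mul {n : ℕ} (α : ℝ) (f : (Fin n → ℂ) → ℂ) (z : Fin n → ℂ) :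
    fockModulus α f z = ‖f z * (Real.exp (-(α / 2) * normSqC z) : ℝ)‖ₑ := by
  rw [← ofReal_norm, norm_mul, Complex.norm_real, Real.norm_of_nonneg (Real.exp_nonneg _),
    fockModulus]

/-- The `p`-th power of a sum of Gaussians at lattice points: subadditivity of `x ^ p` for `p ≤ 1`,
Hölder's inequality and the boundedness of `∑ e^{-α|z - u|²/2}` for `p > 1`. -/
theorem exists_rpow_sum_gaussian_le {s α p : ℝ} (hs : 0 < s) (hα : 0 < α) (hp : 0 < p) (n : ℕ) :
    ∃ A : ℝ≥0∞, A ≠ ∞ ∧ ∃ c : ℝ, 0 < c ∧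
      ∀ (S : Finset (Fin n → ℤ × ℤ)) (x : (Fin n → ℤ × ℤ) → ℝ≥0∞) (z : Fin n → ℂ),
      (∑ m ∈ S, x m * ENNReal.ofReal (Real.exp (-(α / 2) * normSqC (z - latticePoint s m)))) ^ p
        ≤ A * ∑ m ∈ S, x m ^ p *
          ENNReal.ofReal (Real.exp (-c * normSqC (z - latticePoint s m))) := by
  rcases le_or_gt p 1 with hp1 | hp1
  · refine ⟨1, ENNReal.one_ne_top, α / 2 * p, by positivity, fun S x z => ?_⟩
    rw [one_mul]
    refine (ENNReal.sum_rpow_le_sum_rpow S _ hp hp1).trans_eq (Finset.sum_congr rfl fun m _ => ?_)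
    rw [ENNReal.mul_rpow_of_nonneg _ _ hp.le, ENNReal.ofReal_rpow_of_pos (Real.exp_pos _),
      ← Real.exp_mul]
    congr 3; ring
  · obtain ⟨A, hA, h⟩ := exists_tsum_gaussian_le hs (half_pos hα) n
    have hpinv : 0 ≤ 1 - p⁻¹ := by
      rw [sub_nonneg]; exact inv_le_one_of_one_le₀ hp1.le
    refine ⟨(A ^ (1 - p⁻¹)) ^ p, ENNReal.rpow_ne_top_of_nonneg hp.le
      (ENNReal.rpow_ne_top_of_nonneg hpinv hA), α / 2, by positivity, fun S x z => ?_⟩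
    set g := fun m => ENNReal.ofReal (Real.exp (-(α / 2) * normSqC (z - latticePoint s m)))
    have h1 := ENNReal.inner_le_weight_mul_Lp_of_nonneg S hp1.le g x
    have h2 : ∑ m ∈ S, g m ≤ A := (ENNReal.sum_le_tsum S).trans (h z)
    calc (∑ m ∈ S, x m * g m) ^ p = (∑ m ∈ S, g m * x m) ^ p := by simp only [mul_comm]
      _ ≤ (A ^ (1 - p⁻¹) * (∑ m ∈ S, g m * x m ^ p) ^ p⁻¹) ^ p := by
          gcongr
          exact h1.trans (by gcongr)
      _ = _ := by
          rw [ENNReal.mul_rpow_of_nonneg _ _ hp.le, ← ENNReal.rpow_mul _ p⁻¹,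
            inv_mul_cancel₀ hp.ne', ENNReal.rpow_one]
          simp only [mul_comm, g]

/-- The combination `∑ ε_m * e_m ^ (1 / p) * k_m` of kernels at the lattice points of `S`, with
signs `ε`. -/
def testFunction {n : ℕ} (s α p : ℝ) (S : Finset (Fin n → ℤ × ℤ)) (e : (Fin n → ℤ × ℤ) → NNReal)
    (ε : S → ℤˣ) (z : Fin n → ℂ) : ℂ :=
  ∑ m : S, ((ε m : ℤ) : ℂ) * (((e m ^ (1 / p) : NNReal) : ℂ) *
    fockKernel α (latticePoint s m.1) z)

theorem differentiable_testFunction {n : ℕ} (s α p : ℝ) (S : Finset (Fin n → ℤ × ℤ))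
    (e : (Fin n → ℤ × ℤ) → NNReal) (ε : S → ℤˣ) :
    Differentiable ℂ (testFunction s α p S e ε) := by
  have := fun m : S => differentiable_fockKernel α (latticePoint s m.1)
  unfold testFunction
  fun_prop

theorem enorm_coe_mul_fockKernel {n : ℕ} (α : ℝ) (u z : Fin n → ℂ) (x : NNReal) :
    ‖(x : ℂ) * fockKernel α u z * (Real.exp (-(α / 2) * normSqC z) : ℝ)‖ₑ
      = x * ENNReal.ofReal (Real.exp (-(α / 2) * normSqC (z - u))) := by
  rw [mul_assoc, enorm_mul, ← fockModulus_eq_enorm_mul, fockModulus_fockKernel]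
  congr 1
  rw [← ofReal_norm]
  simp

/-- The norms of the test functions are controlled uniformly in the choice of signs. -/
theorem CubeComparable.exists_lintegral_testFunction_le {n : ℕ} {ν : Measure (Fin n → ℂ)}
    {s θ α p : ℝ} {C : ℝ≥0∞} (hν : CubeComparable ν (2 * s) θ C) (hC : C ≠ ∞) (hs : 0 < s)
    (hθ : 0 < θ) (hα : 0 < α) (hp : 0 < p) :
    ∃ A : ℝ≥0∞, A ≠ ∞ ∧ ∀ (S : Finset (Fin n → ℤ × ℤ)) (e : (Fin n → ℤ × ℤ) → NNReal)
      (ε : S → ℤˣ), ∫⁻ z, fockModulus α (testFunction s α p S e ε) z ^ p ∂ν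
        ≤ A * ∑ m ∈ S, e m * ν (cell s m) := by
  obtain ⟨A, hA, c, hc, h⟩ := exists_rpow_sum_gaussian_le hs hα hp n
  obtain ⟨B, hB, hG⟩ := hν.exists_lintegral_gaussian_le hC hs hθ hc
  refine ⟨A * B, ENNReal.mul_ne_top hA hB, fun S e ε => ?_⟩
  have hgm : ∀ m, Measurable fun z : Fin n → ℂ =>
      ENNReal.ofReal (Real.exp (-c * normSqC (z - latticePoint s m))) := fun m =>
    (ENNReal.continuous_ofReal.comp (by fun_prop)).measurable
  have hsign : ∀ u : ℤˣ, ‖((u : ℤ) : ℂ)‖ₑ = 1 := fun u => by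
    rcases Int.units_eq_one_or u with rfl | rfl <;> simp
  calc ∫⁻ z, fockModulus α (testFunction s α p S e ε) z ^ p ∂ν
      ≤ ∫⁻ z, A * ∑ m ∈ S, e m * ENNReal.ofReal (Real.exp (-c * normSqC (z - latticePoint s m)))
          ∂ν := by
        refine lintegral_mono fun z => ?_
        have h1 : fockModulus α (testFunction s α p S e ε) z ≤
            ∑ m ∈ S, ((e m ^ (1 / p) : NNReal) : ℝ≥0∞) *
              ENNReal.ofReal (Real.exp (-(α / 2) * normSqC (z - latticePoint s m))) := by
          rw [fockModulus_eq_enorm_mul, testFunction, Finset.sum_mul, ← Finset.sum_coe_sort S]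
          refine (enorm_sum_le _ _).trans_eq (Finset.sum_congr rfl fun m _ => ?_)
          rw [mul_assoc, enorm_mul, hsign, one_mul, enorm_coe_mul_fockKernel]
        refine (ENNReal.rpow_le_rpow h1 hp.le).trans ((h S _ z).trans_eq ?_)
        congr 1
        refine Finset.sum_congr rfl fun m _ => ?_
        rw [← ENNReal.coe_rpow_of_nonneg _ hp.le, ← NNReal.rpow_mul, one_div_mul_cancel hp.ne',
          NNReal.rpow_one]
    _ = A * ∑ m ∈ S, e m *
          ∫⁻ z, ENNReal.ofReal (Real.exp (-c * normSqC (z - latticePoint s m))) ∂ν := by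
        rw [lintegral_const_mul _ (Finset.measurable_fun_sum _ fun m _ => (hgm m).const_mul _),
          lintegral_finsetSum _ fun m _ => (hgm m).const_mul _]
        simp only [lintegral_const_mul _ (hgm _)]
    _ ≤ A * ∑ m ∈ S, e m * (B * ν (cell s m)) := by
        gcongr with m
        exact hG m
    _ = _ := by
        rw [mul_assoc, Finset.mul_sum (a := B)]
        congr 1
        exact Finset.sum_congr rfl fun m _ => mul_left_comm _ _ _

theorem exp_le_gaussian_of_mem_cell {n : ℕ} {s α : ℝ} (hs : 0 < s) (hα : 0 < α)
    {m : Fin n → ℤ × ℤ} {z : Fin n → ℂ} (hz : z ∈ cell s m) :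
    Real.exp (-(α / 2) * (n * (2 * s ^ 2))) ≤
      Real.exp (-(α / 2) * normSqC (z - latticePoint s m)) := by
  have : normSqC (z - latticePoint s m) ≤ n * (2 * s ^ 2) := by
    rw [show (n : ℝ) * (2 * s ^ 2) = ∑ _i : Fin n, 2 * s ^ 2 by simp]
    refine Finset.sum_le_sum fun i _ => ?_
    obtain ⟨⟨h1, h2⟩, h3, h4⟩ := (mem_cell_iff hs).1 hz i
    rw [← Complex.normSq_eq_norm_sq, Complex.normSq_apply]
    simp only [Pi.sub_apply, Complex.sub_re, Complex.sub_im, latticePoint]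
    nlinarith
  rw [Real.exp_le_exp]
  nlinarith

/-- On the cell of `m`, the average over the signs of a test function is bounded below by the term
of index `m`. -/
theorem card_mul_rpow_le_sum_testFunction {n : ℕ} {s α p q : ℝ} (hs : 0 < s) (hα : 0 < α)
    (hp : 0 < p) (hq : 0 < q) (S : Finset (Fin n → ℤ × ℤ)) (e : (Fin n → ℤ × ℤ) → NNReal)
    {m : Fin n → ℤ × ℤ} (hm : m ∈ S) {z : Fin n → ℂ} (hz : z ∈ cell s m) :
    (Fintype.card (S → ℤˣ) : ℝ≥0∞) * ((e m : ℝ≥0∞) ^ (q / p) *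
      ENNReal.ofReal (Real.exp (-(α / 2) * (n * (2 * s ^ 2)))) ^ q) ≤
      2 * ∑ ε : S → ℤˣ, fockModulus α (testFunction s α p S e ε) z ^ q := by
  classical
  have h := card_mul_enorm_rpow_le_sum_signs (fun m : S => ((e m ^ (1 / p) : NNReal) : ℂ) *
    fockKernel α (latticePoint s m.1) z * (Real.exp (-(α / 2) * normSqC z) : ℝ)) ⟨m, hm⟩ hq
  have h1 : ∀ ε : S → ℤˣ, fockModulus α (testFunction s α p S e ε) z
      = ‖∑ m : S, ((ε m : ℤ) : ℂ) * (((e m ^ (1 / p) : NNReal) : ℂ) *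
    fockKernel α (latticePoint s m.1) z * (Real.exp (-(α / 2) * normSqC z) : ℝ))‖ₑ := fun ε => by
    rw [fockModulus_eq_enorm_mul, testFunction, Finset.sum_mul]
    simp only [mul_assoc]
  simp only [h1]
  refine le_trans ?_ h
  rw [enorm_coe_mul_fockKernel, ENNReal.mul_rpow_of_nonneg _ _ hq.le,
    ← ENNReal.coe_rpow_of_nonneg _ hq.le, ← NNReal.rpow_mul, one_div_mul_eq_div,
    ENNReal.coe_rpow_of_nonneg _ (div_pos hq hp).le]
  exact mul_le_mul' le_rfl (mul_le_mul' le_rfl (ENNReal.rpow_le_rpow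
    (ENNReal.ofReal_le_ofReal (exp_le_gaussian_of_mem_cell hs hα hz)) hq.le))

theorem ProductEmbedding.cellEmbedding {n k : ℕ} {w : (Fin n → ℂ) → ℝ}
    (hw : IsWeight w) {s θ : ℝ} {C : ℝ≥0∞} (hν : CubeComparable (weightMeasure w) (2 * s) θ C)
    (hC : C ≠ ∞) (hs : 0 < s) (hθ : 0 < θ) {μ : Measure (Fin n → ℂ)} {p q α : Fin k → ℝ}
    (hp : ∀ j, 0 < p j) (hq : ∀ j, 0 < q j) (hα : ∀ j, 0 < α j)
    (h : ProductEmbedding w μ p q α) :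
    CellEmbedding s (∑ j, q j / p j) (weightMeasure w) μ := by
  obtain ⟨B, hB, h⟩ := h
  choose A hA hAle using fun j =>
    hν.exists_lintegral_testFunction_le hC hs hθ (hα j) (hp j)
  have hqp : ∀ j, 0 < q j / p j := fun j => div_pos (hq j) (hp j)
  set ν := weightMeasure w with hνdef
  set b : Fin k → ℝ≥0∞ := fun j => ENNReal.ofReal (Real.exp (-(α j / 2) * (n * (2 * s ^ 2))))
  set β := ∏ j, b j ^ q j with hβ
  have hβ0 : β ≠ 0 := Finset.prod_ne_zero_iff.2 fun j _ =>
    (ENNReal.rpow_pos (ENNReal.ofReal_pos.2 (Real.exp_pos _)) ENNReal.ofReal_ne_top).ne'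
  have hβtop : β ≠ ∞ := ENNReal.prod_ne_top fun j _ =>
    ENNReal.rpow_ne_top_of_nonneg (hq j).le ENNReal.ofReal_ne_top
  set D := ENNReal.ofReal B * ∏ j, A j ^ (q j / p j) with hD
  have hDtop : D ≠ ∞ := ENNReal.mul_ne_top ENNReal.ofReal_ne_top (ENNReal.prod_ne_top fun j _ =>
    ENNReal.rpow_ne_top_of_nonneg (hqp j).le (hA j))
  refine ⟨2 ^ k * D / β, ENNReal.div_ne_top (ENNReal.mul_ne_top (by finiteness) hDtop) hβ0,
    fun S e => ?_⟩
  set T := ∑ m ∈ S, e m * ν (cell s m) with hT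
  have hTtop : T ≠ ∞ := ENNReal.sum_ne_top.2 fun m _ => ENNReal.mul_ne_top ENNReal.coe_ne_top
    ((measure_mono (cell_subset_cube_cellCenter hs m)).trans_lt
      (weightMeasure_cube_lt_top hw hs.le _)).ne
  set M : ℝ≥0∞ := ((Fintype.card (S → ℤˣ) : ℕ) : ℝ≥0∞) with hM
  have hM0 : M ≠ 0 := by simp [hM]
  have hMtop : M ≠ ∞ := ENNReal.natCast_ne_top _
  let F : (j : Fin k) → (S → ℤˣ) → (Fin n → ℂ) → ℂ := fun j ε =>
    testFunction s (α j) (p j) S e ε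
  have hFd : ∀ j ε, Differentiable ℂ (F j ε) := fun j ε => differentiable_testFunction _ _ _ _ _ _
  have hFnorm : ∀ j ε, weightedNorm (p j) (α j) w (F j ε) ^ p j ≤ A j * T := fun j ε => by
    rw [weightedNorm_rpow (hp j) _ hw (hFd j ε).continuous]
    exact hAle j S e ε
  have hFmem : ∀ j ε, F j ε ∈ fockSpace (p j) (α j) w := fun j ε => by
    refine ⟨hFd j ε, ?_⟩
    have := (hFnorm j ε).trans_lt (ENNReal.mul_lt_top (hA j).lt_top hTtop.lt_top)
    exact (ENNReal.rpow_lt_top_iff_of_pos (hp j)).1 this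
  have hFm : ∀ j ε, Measurable fun z => fockModulus (α j) (F j ε) z ^ q j := fun j ε =>
    (continuous_fockModulus _ (hFd j ε).continuous).measurable.pow_const _
  have hupper : ∀ ε : Fin k → S → ℤˣ,
      ∫⁻ z, ∏ j, fockModulus (α j) (F j (ε j)) z ^ q j ∂μ ≤ D * T ^ (∑ j, q j / p j) := by
    intro ε
    have h1 := h (fun j => F j (ε j)) fun j => hFmem j (ε j)
    simp only [ofReal_prod_eq_prod_fockModulus hq] at h1
    refine h1.trans ?_
    rw [hD, mul_assoc, ENNReal.rpow_finset_sum_of_nonneg _ fun j => (hqp j).le,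
      ← Finset.prod_mul_distrib]
    gcongr with j
    rw [← ENNReal.mul_rpow_of_nonneg _ _ (hqp j).le]
    calc weightedNorm (p j) (α j) w (F j (ε j)) ^ q j
        = (weightedNorm (p j) (α j) w (F j (ε j)) ^ p j) ^ (q j / p j) := by
          rw [← ENNReal.rpow_mul, mul_div_cancel₀ _ (hp j).ne']
      _ ≤ _ := ENNReal.rpow_le_rpow (hFnorm j (ε j)) (hqp j).le
  have hlower : ∀ m ∈ S, ∀ z ∈ cell s m,
      M ^ k * ((e m : ℝ≥0∞) ^ (∑ j, q j / p j) * β) ≤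
        2 ^ k * ∑ ε : Fin k → S → ℤˣ, ∏ j, fockModulus (α j) (F j (ε j)) z ^ q j := by
    intro m hm z hz
    have h1 : ∏ j : Fin k, (M * ((e m : ℝ≥0∞) ^ (q j / p j) * b j ^ q j)) ≤
        ∏ j, (2 * ∑ ε : S → ℤˣ, fockModulus (α j) (F j ε) z ^ q j) :=
      Finset.prod_le_prod' fun j _ =>
        card_mul_rpow_le_sum_testFunction hs (hα j) (hp j) (hq j) S e hm hz
    rw [Finset.prod_mul_distrib, Finset.prod_mul_distrib, Finset.prod_mul_distrib,
      Finset.prod_univ_sum, Fintype.piFinset_univ,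
      ← ENNReal.rpow_finset_sum_of_nonneg _ fun j => (hqp j).le] at h1
    simpa using h1
  -- sum over all sign patterns, with independent signs for the different factors
  have hmain : M ^ k * β * ∑ m ∈ S, (e m : ℝ≥0∞) ^ (∑ j, q j / p j) * μ (cell s m) ≤
      M ^ k * (2 ^ k * D * T ^ (∑ j, q j / p j)) := by
    calc M ^ k * β * ∑ m ∈ S, (e m : ℝ≥0∞) ^ (∑ j, q j / p j) * μ (cell s m)
        = ∑ m ∈ S, ∫⁻ z in cell s m, M ^ k * ((e m : ℝ≥0∞) ^ (∑ j, q j / p j) * β) ∂μ := by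
          rw [Finset.mul_sum]
          refine Finset.sum_congr rfl fun m _ => ?_
          rw [setLIntegral_const]; ring
      _ ≤ ∑ m ∈ S, ∫⁻ z in cell s m,
            2 ^ k * ∑ ε : Fin k → S → ℤˣ, ∏ j, fockModulus (α j) (F j (ε j)) z ^ q j ∂μ :=
          Finset.sum_le_sum fun m hm =>
            setLIntegral_mono' (measurableSet_cell s m) (hlower m hm)
      _ ≤ ∫⁻ z, 2 ^ k * ∑ ε : Fin k → S → ℤˣ, ∏ j, fockModulus (α j) (F j (ε j)) z ^ q j ∂μ := by
          rw [lintegral_eq_tsum_cell s μ]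
          exact ENNReal.sum_le_tsum S
      _ = 2 ^ k * ∑ ε : Fin k → S → ℤˣ, ∫⁻ z, ∏ j, fockModulus (α j) (F j (ε j)) z ^ q j ∂μ := by
          have hm : ∀ ε : Fin k → S → ℤˣ, Measurable fun z =>
              ∏ j, fockModulus (α j) (F j (ε j)) z ^ q j := fun ε =>
            Finset.measurable_fun_prod _ fun j _ => hFm j (ε j)
          rw [lintegral_const_mul _ (Finset.measurable_fun_sum _ fun ε _ => hm ε),
            lintegral_finsetSum _ fun ε _ => hm ε]
      _ ≤ 2 ^ k * ∑ _ε : Fin k → S → ℤˣ, D * T ^ (∑ j, q j / p j) := by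
          gcongr with ε
          exact hupper ε
      _ = _ := by
          rw [Finset.sum_const, Finset.card_univ, nsmul_eq_mul, Fintype.card_fun (α := Fin k),
            Fintype.card_fin, Nat.cast_pow]
          ring
  rw [mul_assoc, ENNReal.mul_le_mul_iff_right (pow_ne_zero k hM0)
    (ENNReal.pow_ne_top hMtop)] at hmain
  rw [ENNReal.mul_comm_div, ← mul_div_assoc, ENNReal.le_div_iff_mul_le (Or.inl hβ0) (Or.inl hβtop),
    mul_comm]
  exact hmain

end

theorem theorem5p2 (n k : ℕ) (hk : 1 ≤ k) (w : (Fin n → ℂ) → ℝ) (hw : IsAResInfty w)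
    (μ : Measure (Fin n → ℂ)) (p q : Fin k → ℝ) (hp : ∀ j, 0 < p j) (hq : ∀ j, 0 < q j) :
    (IsFockCarleson w (∑ j, q j / p j) μ ↔
      ∃ α : Fin k → ℝ, (∀ j, 0 < α j) ∧ ProductEmbedding w μ p q α) ∧
    (IsFockCarleson w (∑ j, q j / p j) μ ↔
      ∀ α : Fin k → ℝ, (∀ j, 0 < α j) → ProductEmbedding w μ p q α) := by
  obtain ⟨hweight, r, θ, hr, hθ, C, hC, hν⟩ := hw.exists_cubeComparable
  rw [show r = 2 * (r / 2) by ring] at hν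
  have hs := half_pos hr
  have hlam : 0 < ∑ j, q j / p j :=
    Finset.sum_pos (fun j _ => div_pos (hq j) (hp j)) ⟨⟨0, hk⟩, Finset.mem_univ _⟩
  have h13 : IsFockCarleson w (∑ j, q j / p j) μ →
      ∀ α : Fin k → ℝ, (∀ j, 0 < α j) → ProductEmbedding w μ p q α := by
    rintro ⟨p', q', α', hp', hq', hα', hlam', hcar⟩ α hα
    have h1 := ((isCarleson_iff_productEmbedding hq' w μ).1 hcar).cellEmbedding hweight hν hC hs hθ
      (fun _ => hp') (fun _ => hq') (fun _ => hα')
    simp only [Finset.univ_unique, Finset.sum_singleton, ← hlam'] at h1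
    exact h1.productEmbedding hk hweight hν hC hs hθ hp hq hα
  have h21 : (∃ α : Fin k → ℝ, (∀ j, 0 < α j) ∧ ProductEmbedding w μ p q α) →
      IsFockCarleson w (∑ j, q j / p j) μ := by
    rintro ⟨α, hα, hemb⟩
    have h1 := hemb.cellEmbedding hweight hν hC hs hθ hp hq hα
    refine ⟨1, ∑ j, q j / p j, 1, one_pos, hlam, one_pos, (div_one _).symm,
      (isCarleson_iff_productEmbedding hlam w μ).2 ?_⟩
    refine CellEmbedding.productEmbedding le_rfl hweight hν hC hs hθ (fun _ => one_pos)
      (fun _ => hlam) (fun _ => one_pos) ?_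
    simpa using h1
  have h32 : (∀ α : Fin k → ℝ, (∀ j, 0 < α j) → ProductEmbedding w μ p q α) →
      ∃ α : Fin k → ℝ, (∀ j, 0 < α j) ∧ ProductEmbedding w μ p q α := fun h =>
    ⟨fun _ => 1, fun _ => one_pos, h _ fun _ => one_pos⟩
  exact ⟨⟨fun h => h32 (h13 h), h21⟩, h13, fun h => h21 (h32 h)⟩
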